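/- Let $p$ be an odd prime, let $S$ be a finite $p$-group and let $\mathcal F$ be a saturated fusion system on $S$. A subgroup $E\le S$ is \emph{$\mathcal F$-essential} if it is $\mathcal F$-centric (the image $E\alpha$ contains $C_S(E\alpha)$ for every $\alpha\in\mathrm{Hom}_{\mathcal F}(E,S)$), fully normalized in $\mathcal F$ ($|N_S(E)|\ge |N_S(E\alpha)|$ for every $\alpha\in\mathrm{Hom}_{\mathcal F}(E,S)$), and $\mathrm{Out}_{\mathcal F}(E)=\mathrm{Aut}_{\mathcal F}(E)/\mathrm{Inn}(E)$ contains a strongly $p$-embedded subgroup. An \emph{$\mathcal F$-pearl} is an $\mathcal F$-essential subgroup of $S$ that is either elementary abelian of order $p^2$ or non-abelian of order $p^3$. For $Q\le S$ set $N^0(Q)=Q$ and $N^i(Q)=N_S(N^{i-1}(Q))$ for $i\ge 1$. For $P\le S$, $\mathrm{Aut}_S(P)$ denotes the group of automorphisms of $P$ induced by conjugation by elements of $N_S(P)$. Let $E$ be an $\mathcal F$-pearl with $[S:E]=p^m$. Then: (1) $E$ has maximal normalizer tower in $S$, that is, $N^m(E)=S$ and $[N^i(E):N^{i-1}(E)]=p$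 for every $1\le i\le m$; (2) the groups $N^0(E),\dots,N^m(E)$ are the only subgroups of $S$ containing $E$; (3) for every $1\le i\le m-1$ the group $N^i(E)$ is not $\mathcal F$-essential, and $\mathrm{Aut}_S(N^i(E))$ is a normal subgroup of $\mathrm{Aut}_{\mathcal F}(N^i(E))$; (4) every element of $N_{\mathrm{Aut}_{\mathcal F}(E)}(\mathrm{Aut}_S(E))$ is the restriction to $E$ of some element of $\mathrm{Aut}_{\mathcal F}(S)$ that normalizes $N^i(E)$ for every $0\le i\le m$. -/

import Mathlib

universe u

/-! ### The normalizer tower -/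

section Tower

variable {G : Type u} [Group G]

/-- `normalizerTower Q i` is `N^i(Q)`: `N^0(Q) = Q` and `N^(i+1)(Q)` is the normalizer of `N^i(Q)`
in the ambient group. -/
def normalizerTower (Q : Subgroup G) : ℕ → Subgroup G
  | 0 => Q
  | i + 1 => Subgroup.normalizer (normalizerTower Q i : Set G)

/-- For a subgroup `Q` of index `p ^ m`: the normalizer tower reaches the whole group at step `m`,
and each of its `m` steps has index `p`. -/
def HasMaximalNormalizerTower (p m : ℕ) (Q : Subgroup G) : Prop :=
  normalizerTower Q m = ⊤ ∧
    ∀ i, 1 ≤ i → i ≤ m → (normalizerTower Q (i - 1)).relIndex (normalizerTower Q i) = p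

/-- `H` is strongly `p`-embedded in the (finite) group `G`: it is proper, `p` divides `|H|`, and
`p` does not divide `|H ∩ x H x⁻¹|` for any `x ∉ H`. -/
def IsStronglyEmbedded (p : ℕ) (H : Subgroup G) : Prop :=
  H ≠ ⊤ ∧ p ∣ Nat.card H ∧
    ∀ x : G, x ∉ H → ¬ p ∣ Nat.card (H ⊓ H.map (MulAut.conj x).toMonoidHom : Subgroup G)

end Tower

/-! ### Fusion systems -/

/-- A fusion system on `S`: a category whose objects are the subgroups of `S` and whose morphisms
are injective group homomorphisms, including all those induced by conjugation in `S`, such that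
every morphism is an isomorphism of the category onto its image followed by an inclusion. -/
structure FusionSystem (S : Type u) [Group S] where
  /-- The set `Hom_F(P, Q)`. -/
  hom : ∀ P Q : Subgroup S, Set (P →* Q)
  injective_of_mem : ∀ {P Q : Subgroup S} {φ : P →* Q}, φ ∈ hom P Q → Function.Injective φ
  conj_mem : ∀ {P Q : Subgroup S} (φ : P →* Q) (g : S),
    (∀ x : P, (φ x : S) = g * x * g⁻¹) → φ ∈ hom P Q
  comp_mem : ∀ {P Q R : Subgroup S} {φ : P →* Q} {ψ : Q →* R},
    φ ∈ hom P Q → ψ ∈ hom Q R → ψ.comp φ ∈ hom P R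
  /-- If `R` is the image of `φ ∈ Hom_F(P, Q)` and `e : P ≃* R` is the isomorphism that `φ`
  induces, then both `e` and its inverse are morphisms of the fusion system. -/
  iso_mem : ∀ {P Q R : Subgroup S} {φ : P →* Q} (e : P ≃* R), φ ∈ hom P Q →
    (∀ x : P, (e x : S) = φ x) → e.toMonoidHom ∈ hom P R ∧ e.symm.toMonoidHom ∈ hom R P

/-- `Inn(P)`. -/
def innGroup (P : Type u) [Group P] : Subgroup (MulAut P) :=
  (MulAut.conj : P →* MulAut P).range

theorem innGroup_normal (P : Type u) [Group P] : (innGroup P).Normal := by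
  refine ⟨?_⟩
  rintro _ ⟨g, rfl⟩ φ
  refine ⟨φ g, ?_⟩
  ext x
  simp

namespace FusionSystem

variable {S : Type u} [Group S]

/-- `Aut_S(P)`: the automorphisms of `P` induced by conjugation by elements of `N_S(P)`. -/
def autS (P : Subgroup S) : Subgroup (MulAut P) :=
  P.normalizerMonoidHom.range

/-- The image, as a subgroup of `S`, of a homomorphism between subgroups of `S`. -/
def image {P Q : Subgroup S} (φ : P →* Q) : Subgroup S :=
  (Q.subtype.comp φ).range

variable (F : FusionSystem S)

/-- `Aut_F(P)`. -/
def aut (P : Subgroup S) : Subgroup (MulAut P) where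
  carrier := {φ | φ.toMonoidHom ∈ F.hom P P}
  one_mem' := F.conj_mem _ 1 (by intro x; simp)
  mul_mem' := by
    intro φ ψ hφ hψ
    exact F.comp_mem hψ hφ
  inv_mem' := by
    intro φ hφ
    exact (F.iso_mem (φ : P ≃* P) hφ (fun _ => rfl)).2

theorem autS_le_aut (P : Subgroup S) : autS P ≤ F.aut P := by
  rintro _ ⟨g, rfl⟩
  exact F.conj_mem _ (g : S) (fun x => rfl)

instance innGroup_subgroupOf_normal (P : Subgroup S) :
    ((innGroup P).subgroupOf (F.aut P)).Normal :=
  haveI := innGroup_normal P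
  Subgroup.normal_subgroupOf

/-- `Out_F(P) = Aut_F(P) / Inn(P)`. -/
abbrev Out (P : Subgroup S) : Type u :=
  F.aut P ⧸ (innGroup P).subgroupOf (F.aut P)

/-- `P` and `Q` are isomorphic in the category. -/
def IsConj (P Q : Subgroup S) : Prop :=
  ∃ e : P ≃* Q, e.toMonoidHom ∈ F.hom P Q

/-- `Aut_S(P)` is a Sylow `p`-subgroup of `Aut_F(P)`. -/
def IsFullyAutomized (p : ℕ) (P : Subgroup S) : Prop :=
  ∃ T : Sylow p (F.aut P), (T : Subgroup (F.aut P)) = (autS P).subgroupOf (F.aut P)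

/-- For an isomorphism `e : Q ≃* P`, the subgroup `N_e` of all `g ∈ N_S(Q)` such that
`e c_g e⁻¹ ∈ Aut_S(P)`, where `c_g` is conjugation by `g` on `Q`. -/
def extender {P Q : Subgroup S} (e : Q ≃* P) : Subgroup S :=
  (((autS P).comap (MulAut.congr e).toMonoidHom).comap Q.normalizerMonoidHom).map
    (Subgroup.normalizer (Q : Set S)).subtype

/-- Each isomorphism `e : Q ≃* P` of the fusion system extends to a morphism from `N_e` to `S`
(note that `Q ≤ N_e`). -/
def IsReceptive (P : Subgroup S) : Prop :=
  ∀ (Q : Subgroup S) (e : Q ≃* P), e.toMonoidHom ∈ F.hom Q P →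
    ∃ ψ ∈ F.hom (extender e) ⊤,
      ∀ (x : Q) (hx : (x : S) ∈ extender e), (ψ ⟨x, hx⟩ : S) = e x

/-- Each subgroup of `S` is conjugate in the fusion system to one that is fully automized and
receptive. -/
def IsSaturated (p : ℕ) : Prop :=
  ∀ P : Subgroup S, ∃ Q : Subgroup S, F.IsConj P Q ∧ F.IsFullyAutomized p Q ∧ F.IsReceptive Q

/-- The image of each morphism from `E` to `S` contains its centralizer in `S`. -/
def IsCentric (E : Subgroup S) : Prop :=
  ∀ α ∈ F.hom E ⊤, Subgroup.centralizer (image α : Set S) ≤ image α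

def IsFullyNormalized (E : Subgroup S) : Prop :=
  ∀ α ∈ F.hom E ⊤, Nat.card (Subgroup.normalizer (image α : Set S)) ≤
    Nat.card (Subgroup.normalizer (E : Set S))

/-- `E` is `F`-essential. -/
def IsEssential (p : ℕ) (E : Subgroup S) : Prop :=
  F.IsCentric E ∧ F.IsFullyNormalized E ∧ ∃ H : Subgroup (F.Out E), IsStronglyEmbedded p H

/-- An `F`-pearl: an `F`-essential subgroup that is either elementary abelian of order `p ^ 2` or
non-abelian of order `p ^ 3`. -/
def IsPearl (p : ℕ) (E : Subgroup S) : Prop :=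
  F.IsEssential p E ∧
    ((Nat.card E = p ^ 2 ∧ (∀ x y : E, x * y = y * x) ∧ ∀ x : E, x ^ p = 1) ∨
      (Nat.card E = p ^ 3 ∧ ¬ ∀ x y : E, x * y = y * x))

theorem le_extender {P Q : Subgroup S} (e : Q ≃* P) : Q ≤ extender e := by
  intro g hg
  refine ⟨⟨g, Subgroup.le_normalizer hg⟩, ?_, rfl⟩
  refine ⟨⟨e ⟨g, hg⟩, Subgroup.le_normalizer (e ⟨g, hg⟩).2⟩, ?_⟩
  ext x
  have h : e (⟨g, hg⟩ * e.symm x * ⟨g, hg⟩⁻¹) = e ⟨g, hg⟩ * x * (e ⟨g, hg⟩)⁻¹ := by simp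
  exact (congrArg Subtype.val h).symm

end FusionSystem

/-!
The argument uses only that `E` contains its centralizer and has order `p ^ 2`, or order `p ^ 3`
without being abelian (`Subgroup.IsPearlShaped`), that `E` is centric, and that the fusion system is
saturated.

*The overgroups of `E`.* Let `A` be a self-centralizing subgroup of order `p ^ 2` of a finite
`p`-group `G`. A noncentral element of `A` has centralizer `A`, hence `|G| / p ^ 2` conjugates, and
these lie in one coset of `G'`; so `|G : G'| ≤ p ^ 2`
(`IsPGroup.index_commutator_le_sq_of_card_sq`). Moreover `A` is not contained in `G'` if `A ≠ G`
(`IsPGroup.not_le_commutator_of_card_sq`). Hence `|G : G'H| ≤ p` for each normal subgroup `H ≥ A`,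
which makes `G / H` cyclic and then of order at most `p`
(`IsPGroup.index_le_of_normal_of_card_sq`). A self-centralizing nonabelian `X` of order `p ^ 3`
reduces to this case, since `X / Z(G)` has order `p ^ 2` and is self-centralizing in `G / Z(G)`
(`IsPGroup.centralizer_map_mk'_center_le`). Applied to the normalizer of a subgroup `H ≥ E`, this
gives `|N_S(H) : H| ≤ p`, from which the tower and the list of overgroups of `E` follow.

*Automorphisms of `P = N^i(E)` for `0 < i < m`.* The group `Aut_F(P)` leaves a maximal subgroup of
`P` invariant (`FusionSystem.exists_invariant`): if `P` properly contains a self-centralizing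
nonabelian group of order `p ^ 3`, the centralizer of the second centre is one; otherwise
`|E| = p ^ 2`, `|P| = p ^ 3`, and the commutator subgroup of `N_S(P)` is the only maximal subgroup
of `P` that is not conjugate to `E`. As `|P : P'| ≤ p ^ 2`, a group of automorphisms that leaves a
maximal subgroup invariant has a normal Sylow `p`-subgroup (`IsPGroup.sylow_mulAut_normal`).

*Saturation.* The image of `E` in a conjugate `Q` of an overgroup `P` of `E` is again pearl-shaped,
because `E` is centric, so `|N_S(Q)| ≤ p |Q|`; thus `P` has maximal normalizer order among its
conjugates (`FusionSystem.card_normalizer_le_of_isConj`). It follows that `Aut_S(P)` is a Sylow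
`p`-subgroup of `Aut_F(P)`, and that each automorphism in `Aut_F(P)` normalizing `Aut_S(P)` extends
to `N_S(P)`. So `Aut_S(N^i(E))` is normal, which is incompatible with a strongly `p`-embedded
subgroup of `Out_F(N^i(E))`, and automorphisms of `E` extend along the tower step by step.
-/

/-! ### Finite `p`-groups: commutator subgroup, centre and centralizers -/

namespace IsPGroup

variable {G : Type*} [Group G] [Finite G] {p : ℕ} [hp : Fact p.Prime]

theorem index_le_of_lt_sq (hG : IsPGroup p G) (H : Subgroup G) (h : H.index < p ^ 2) :
    H.index ≤ p := by
  obtain ⟨n, hn⟩ := hG.index H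
  rw [hn] at h ⊢
  have := (Nat.pow_lt_pow_iff_right hp.out.one_lt).1 h
  calc p ^ n ≤ p ^ 1 := Nat.pow_le_pow_right hp.out.pos (by omega)
    _ = p := pow_one p

theorem card_le_of_lt_sq (hG : IsPGroup p G) (H : Subgroup G) (h : Nat.card H < p ^ 2) :
    Nat.card H ≤ p := by
  obtain ⟨n, hn⟩ := IsPGroup.iff_card.1 (hG.to_subgroup H)
  rw [hn] at h ⊢
  have := (Nat.pow_lt_pow_iff_right hp.out.one_lt).1 h
  calc p ^ n ≤ p ^ 1 := Nat.pow_le_pow_right hp.out.pos (by omega)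
    _ = p := pow_one p

theorem card_le_sq_of_lt_cube (hG : IsPGroup p G) (H : Subgroup G) (h : Nat.card H < p ^ 3) :
    Nat.card H ≤ p ^ 2 := by
  obtain ⟨n, hn⟩ := IsPGroup.iff_card.1 (hG.to_subgroup H)
  rw [hn] at h ⊢
  have := (Nat.pow_lt_pow_iff_right hp.out.one_lt).1 h
  exact Nat.pow_le_pow_right hp.out.pos (by omega)

theorem le_card_of_ne_bot (hG : IsPGroup p G) (H : Subgroup G) (h : H ≠ ⊥) :
    p ≤ Nat.card H := by
  rcases (hG.to_subgroup H).card_eq_or_dvd with h1 | h1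
  · exact absurd (Subgroup.card_eq_one.1 h1) h
  · exact Nat.le_of_dvd Nat.card_pos h1

/-- A `p`-group of order at most `p ^ 2` is abelian. -/
theorem mul_comm_of_card_le_sq (hG : IsPGroup p G) (h : Nat.card G ≤ p ^ 2) (a b : G) :
    a * b = b * a := by
  rcases h.lt_or_eq with h | h
  · have h1 : Nat.card G ≤ p := by
      have := hG.card_le_of_lt_sq ⊤ (by rwa [Subgroup.card_top])
      rwa [Subgroup.card_top] at this
    rcases hG.card_eq_or_dvd with h2 | h2
    · have := (Nat.card_eq_one_iff_unique.1 h2).1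
      exact Subsingleton.elim _ _
    · have h3 : Nat.card G = p := le_antisymm h1 (Nat.le_of_dvd Nat.card_pos h2)
      have := isCyclic_of_prime_card h3
      exact IsCyclic.isMulCommutative.is_comm.comm a b
  · exact (IsPGroup.isMulCommutative_of_card_eq_prime_sq h).is_comm.comm a b


theorem eq_top_of_index_lt (hG : IsPGroup p G) (H : Subgroup G) (h : H.index < p) : H = ⊤ := by
  obtain ⟨n, hn⟩ := hG.index H
  rw [← Subgroup.index_eq_one, hn]
  rw [hn] at h
  have : n < 1 := (Nat.pow_lt_pow_iff_right hp.out.one_lt).1 (by rwa [pow_one])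
  rw [Nat.lt_one_iff.1 this, pow_zero]

theorem commutator_le_of_index_le_sq (hG : IsPGroup p G) (M : Subgroup G) [M.Normal]
    (h : M.index ≤ p ^ 2) : commutator G ≤ M := by
  rw [← Subgroup.Normal.quotient_commutative_iff_commutator_le]
  exact ⟨⟨(hG.to_quotient M).mul_comm_of_card_le_sq (by rwa [← Subgroup.index_eq_card])⟩⟩

/-- The commutator subgroup of a finite `p`-group consists of nongenerators. -/
theorem eq_top_of_sup_commutator_eq_top (hG : IsPGroup p G) (H : Subgroup G)
    (h : H ⊔ commutator G = ⊤) : H = ⊤ := by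
  rcases IsCoatomic.eq_top_or_exists_le_coatom H with h1 | ⟨M, hM, hHM⟩
  · exact h1
  have := hG.isNilpotent
  have hn : M.Normal :=
    Subgroup.NormalizerCondition.normal_of_coatom M Group.normalizerCondition_of_isNilpotent hM
  obtain ⟨x, -, hx⟩ := SetLike.exists_of_lt hM.lt_top
  have hlt : M < M ⊔ Subgroup.zpowers x :=
    lt_of_le_of_ne le_sup_left fun he => hx (by
      rw [he]; exact Subgroup.mem_sup_right (Subgroup.mem_zpowers x))
  have hc := Subgroup.Normal.commutator_le_of_self_sup_commutative_eq_top (hM.2 _ hlt)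
    inferInstance
  exact absurd (top_unique (h ▸ sup_le hHM hc)) hM.1

/-- A finite `p`-group with `|G : G'| ≤ p` is abelian: it is generated by any element outside `G'`,
as `G'` consists of nongenerators. -/
theorem mul_comm_of_index_commutator_le (hG : IsPGroup p G) (h : (commutator G).index ≤ p)
    (a b : G) : a * b = b * a := by
  by_cases ht : commutator G = ⊤
  · have := hG.eq_top_of_sup_commutator_eq_top ⊥ (by simp [ht])
    have h1 : ∀ x : G, x = 1 := fun x => Subgroup.mem_bot.1 (this ▸ Subgroup.mem_top x)
    rw [h1 a, h1 b]
  obtain ⟨x, -, hx⟩ := SetLike.exists_of_lt (lt_top_iff_ne_top.2 ht)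
  have hlt : commutator G < Subgroup.zpowers x ⊔ commutator G :=
    lt_of_le_of_ne le_sup_right fun he => hx (by
      rw [he]; exact Subgroup.mem_sup_left (Subgroup.mem_zpowers x))
  have h1 : Subgroup.zpowers x = ⊤ :=
    hG.eq_top_of_sup_commutator_eq_top _ (hG.eq_top_of_index_lt _
      ((Subgroup.index_strictAnti hlt).trans_le h))
  obtain ⟨i, rfl⟩ := Subgroup.mem_zpowers_iff.1 (h1 ▸ Subgroup.mem_top a : a ∈ Subgroup.zpowers x)
  obtain ⟨j, rfl⟩ := Subgroup.mem_zpowers_iff.1 (h1 ▸ Subgroup.mem_top b : b ∈ Subgroup.zpowers x)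
  exact (Commute.refl x).zpow_zpow i j

/-- A nontrivial normal subgroup of a finite `p`-group meets the centre nontrivially. -/
theorem inf_center_ne_bot (hG : IsPGroup p G) (W : Subgroup G) [W.Normal] (hW : W ≠ ⊥) :
    W ⊓ Subgroup.center G ≠ ⊥ := by
  have hd : p ∣ Nat.card W := by
    rcases (hG.to_subgroup W).card_eq_or_dvd with h1 | h1
    · exact absurd (Subgroup.card_eq_one.1 h1) hW
    · exact h1
  have hG' : IsPGroup p (ConjAct G) := hG
  obtain ⟨b, hb, hne⟩ := hG'.exists_fixed_point_of_prime_dvd_card_of_fixed_point W hd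
    (a := (1 : W)) (fun g => smul_one g)
  intro hbot
  have : (b : G) ∈ W ⊓ Subgroup.center G := by
    refine ⟨b.2, Subgroup.mem_center_iff.2 fun g => ?_⟩
    have := congrArg Subtype.val (hb (ConjAct.toConjAct g))
    rw [ConjAct.Subgroup.val_conj_smul, ConjAct.toConjAct_smul] at this
    exact mul_inv_eq_iff_eq_mul.1 this
  rw [hbot, Subgroup.mem_bot] at this
  exact hne (Subtype.ext this.symm)

/-- In a subgroup `W` of order `p ^ 2` that meets the centre nontrivially, each noncentral element
has the same centralizer as `W`. -/
theorem centralizer_singleton_le (hG : IsPGroup p G) (W : Subgroup G) (hW : Nat.card W = p ^ 2)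
    (hZ : W ⊓ Subgroup.center G ≠ ⊥) {w : G} (hw : w ∈ W) (hwZ : w ∉ Subgroup.center G) :
    Subgroup.centralizer {w} ≤ Subgroup.centralizer (W : Set G) := by
  intro g hg
  have hle : W ⊓ Subgroup.center G ≤ W ⊓ Subgroup.centralizer {g} :=
    inf_le_inf_left _ (Subgroup.center_le_centralizer _)
  have hwg : w ∈ W ⊓ Subgroup.centralizer {g} :=
    ⟨hw, Subgroup.mem_centralizer_singleton_iff.2
      (Subgroup.mem_centralizer_singleton_iff.1 hg).symm⟩
  have h2 : p ^ 2 ≤ Nat.card (W ⊓ Subgroup.centralizer {g} : Subgroup G) := by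
    by_contra hlt
    have h3 := hG.card_le_of_lt_sq _ (not_le.1 hlt)
    have h4 := Subgroup.eq_of_le_of_card_ge hle (h3.trans (hG.le_card_of_ne_bot _ hZ))
    rw [← h4] at hwg
    exact hwZ hwg.2
  have h5 : W ⊓ Subgroup.centralizer {g} = W :=
    Subgroup.eq_of_le_of_card_ge inf_le_left (hW ▸ h2)
  rw [Subgroup.mem_centralizer_iff]
  intro x hx
  rw [SetLike.mem_coe, ← h5] at hx
  exact Subgroup.mem_centralizer_singleton_iff.1 hx.2

end IsPGroup

namespace Subgroup

variable {G : Type*} [Group G]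

theorem relIndex_centralizer_le_ncard [Finite G] (x : G) (D : Subgroup G) (s : Set G)
    (hs : ∀ g ∈ D, g * x * g⁻¹ ∈ s) : (centralizer {x}).relIndex D ≤ s.ncard := by
  rw [relIndex, index_eq_card, ← Nat.card_coe_set_eq]
  refine Nat.card_le_card_of_injective
    (fun q : D ⧸ (centralizer {x}).subgroupOf D =>
      (⟨q.out * x * (q.out : G)⁻¹, hs _ q.out.2⟩ : s)) fun a b hab => ?_
  have h := congrArg Subtype.val hab
  rw [← QuotientGroup.out_eq' a, ← QuotientGroup.out_eq' b, QuotientGroup.eq, mem_subgroupOf,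
    mem_centralizer_singleton_iff]
  simp only at h
  have h2 : (b.out : G) * x = a.out * x * (a.out : G)⁻¹ * b.out := by rw [h]; group
  push_cast
  rw [mul_assoc, h2]; group

theorem index_centralizer_le_ncard [Finite G] (x : G) (s : Set G)
    (hs : ∀ g, g * x * g⁻¹ ∈ s) : (centralizer {x}).index ≤ s.ncard := by
  rw [← relIndex_top_right]
  exact relIndex_centralizer_le_ncard x ⊤ s fun g _ => hs g

end Subgroup

/-! ### Self-centralizing subgroups of order `p ^ 2` and `p ^ 3` -/

namespace Subgroup

variable {G : Type*} [Group G]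

theorem normal_of_le_center {Z : Subgroup G} (h : Z ≤ center G) : Z.Normal :=
  ⟨fun z hz g => by rwa [mem_center_iff.1 (h hz) g, mul_inv_cancel_right]⟩

theorem card_subgroupOf_of_le {A N : Subgroup G} (h : A ≤ N) :
    Nat.card (A.subgroupOf N) = Nat.card A :=
  Nat.card_congr (subgroupOfEquivOfLe h).toEquiv

theorem centralizer_subgroupOf_le {A N : Subgroup G} (h : A ≤ N)
    (hc : centralizer (A : Set G) ≤ A) :
    centralizer (A.subgroupOf N : Set N) ≤ A.subgroupOf N := by
  intro g hg
  rw [mem_subgroupOf]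
  refine hc (mem_centralizer_iff.2 fun x hx => ?_)
  exact congrArg Subtype.val (mem_centralizer_iff.1 hg ⟨x, h hx⟩ hx)

theorem card_comap_mk' [Finite G] (N : Subgroup G) [N.Normal] (Y : Subgroup (G ⧸ N)) :
    Nat.card (Y.comap (QuotientGroup.mk' N)) = Nat.card N * Nat.card Y := by
  have h1 := (Y.comap (QuotientGroup.mk' N)).card_mul_index
  rw [index_comap_of_surjective _ (QuotientGroup.mk'_surjective N), ← N.card_mul_index,
    N.index_eq_card, ← Y.card_mul_index, ← mul_assoc] at h1
  exact Nat.eq_of_mul_eq_mul_right (Nat.pos_of_ne_zero index_ne_zero_of_finite) h1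

theorem comap_map_mk'_of_le (N : Subgroup G) [N.Normal] {X : Subgroup G} (h : N ≤ X) :
    (X.map (QuotientGroup.mk' N)).comap (QuotientGroup.mk' N) = X :=
  comap_map_eq_self (by rwa [QuotientGroup.ker_mk'])

end Subgroup

namespace IsPGroup

open Subgroup
open scoped commutatorElement

variable {G : Type*} [Group G] [Finite G] {p : ℕ} [hp : Fact p.Prime]

theorem mul_comm_of_mem (hG : IsPGroup p G) {A : Subgroup G} (hA : Nat.card A ≤ p ^ 2) {x y : G}
    (hx : x ∈ A) (hy : y ∈ A) : x * y = y * x :=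
  congrArg Subtype.val ((hG.to_subgroup A).mul_comm_of_card_le_sq hA ⟨x, hx⟩ ⟨y, hy⟩)

theorem center_ne_bot (hG : IsPGroup p G) [Nontrivial G] : center G ≠ ⊥ :=
  hG.bot_lt_center.ne'

/-- If `A` is a self-centralizing subgroup of order `p ^ 2` and `x ∈ A` is noncentral, then `A` is
the centralizer of `x`, so `x` has `|G| / p ^ 2` conjugates; all of them lie in one coset of the
commutator subgroup. -/
theorem index_commutator_le_sq_of_card_sq (hG : IsPGroup p G) {A : Subgroup G}
    (hA : Nat.card A = p ^ 2) (hc : centralizer (A : Set G) ≤ A) :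
    (commutator G).index ≤ p ^ 2 := by
  by_cases hAZ : A ≤ center G
  · have h1 : A = ⊤ := top_unique fun g _ => hc (mem_centralizer_iff.2 fun x hx =>
      (mem_center_iff.1 (hAZ hx) g).symm)
    rw [h1, card_top] at hA
    rw [← hA]
    exact Nat.le_of_dvd Nat.card_pos (index_dvd_card _)
  · obtain ⟨x, hx, hxZ⟩ := SetLike.not_le_iff_exists.1 hAZ
    have hZA : center G ≤ A := (center_le_centralizer _).trans hc
    have : Nontrivial G := ⟨x, 1, fun h => hxZ (h ▸ one_mem _)⟩
    have h1 := (hG.centralizer_singleton_le A hA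
      (by rw [inf_eq_right.2 hZA]; exact hG.center_ne_bot) hx hxZ).trans hc
    have h2 := index_centralizer_le_ncard x ((fun c => c * x) '' (commutator G : Set G)) fun g =>
      ⟨⁅g, x⁆, commutator_mem_commutator (mem_top g) (mem_top x), by
        simp [commutatorElement_def]⟩
    have h3 : (centralizer {x}).index ≤ Nat.card (commutator G) :=
      h2.trans (Set.ncard_image_le (Set.toFinite _))
    have h4 : Nat.card (centralizer {x}) ≤ p ^ 2 := hA ▸ card_le_of_le h1
    have h5 := (centralizer {x}).card_mul_index
    rw [← (commutator G).card_mul_index] at h5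
    refine Nat.le_of_mul_le_mul_left ?_ (Nat.card_pos (α := commutator G))
    rw [← h5, mul_comm]
    exact Nat.mul_le_mul h3 h4

/-- A noncentral element of a normal subgroup `W` of order `p ^ 2` has at most `p ^ 2 - 1`
conjugates, hence at most `p`, and its centralizer is that of `W`. -/
theorem index_centralizer_le_of_card_sq (hG : IsPGroup p G) (W : Subgroup G) [W.Normal]
    (hW : Nat.card W = p ^ 2) : (centralizer (W : Set G)).index ≤ p := by
  by_cases hWZ : W ≤ center G
  · rw [centralizer_eq_top_iff_subset.2 hWZ, index_top]
    exact hp.out.one_lt.le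
  · obtain ⟨w, hw, hwZ⟩ := SetLike.not_le_iff_exists.1 hWZ
    have hWbot : W ≠ ⊥ := fun h => hWZ (h ▸ bot_le)
    have h1 := hG.centralizer_singleton_le W hW (hG.inf_center_ne_bot W hWbot) hw hwZ
    have h2 := index_centralizer_le_ncard w ((W : Set G) \ {1}) fun g =>
      ⟨‹W.Normal›.conj_mem w hw g, fun h => hwZ (by
        rw [Set.mem_singleton_iff, conj_eq_one_iff] at h; exact h ▸ one_mem _)⟩
    have h3 : ((W : Set G) \ {1}).ncard < p ^ 2 := by
      rw [← hW, ← SetLike.coe_sort_coe, Nat.card_coe_set_eq]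
      exact Set.ncard_sdiff_singleton_lt_of_mem (one_mem W)
    exact (Nat.le_of_dvd (Nat.pos_of_ne_zero index_ne_zero_of_finite)
      (index_dvd_of_le h1)).trans (hG.index_le_of_lt_sq _ (h2.trans_lt h3))

theorem exists_le_center_card_eq (hG : IsPGroup p G) [Nontrivial G] :
    ∃ Z ≤ center G, Nat.card Z = p := by
  have := hG.center_nontrivial
  have hd : p ∣ Nat.card (center G) := by
    rcases (hG.to_subgroup (center G)).card_eq_or_dvd with h | h
    · exact absurd (Subgroup.card_eq_one.1 h) hG.center_ne_bot
    · exact h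
  obtain ⟨z, hz⟩ := exists_prime_orderOf_dvd_card' p hd
  refine ⟨zpowers (z : G), (zpowers_le).2 z.2, ?_⟩
  rw [Nat.card_zpowers, ← hz, Subgroup.orderOf_coe]

theorem exists_normal_card_sq (hG : IsPGroup p G) (h : p ^ 2 ≤ Nat.card G) :
    ∃ W : Subgroup G, W.Normal ∧ Nat.card W = p ^ 2 := by
  have h1 : 1 < p := hp.out.one_lt
  have : Nontrivial G := Finite.one_lt_card_iff_nontrivial.1 (by nlinarith)
  obtain ⟨Z, hZ, hZp⟩ := hG.exists_le_center_card_eq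
  have hZn : Z.Normal := normal_of_le_center hZ
  have h2 := Z.card_mul_index
  rw [hZp, index_eq_card] at h2
  have : Nontrivial (G ⧸ Z) := Finite.one_lt_card_iff_nontrivial.1 (by nlinarith)
  obtain ⟨Y, hY, hYp⟩ := (hG.to_quotient Z).exists_le_center_card_eq
  have hYn : Y.Normal := normal_of_le_center hY
  exact ⟨Y.comap (QuotientGroup.mk' Z), inferInstance, by rw [card_comap_mk', hZp, hYp, sq]⟩

/-- A proper self-centralizing subgroup `A` of order `p ^ 2` is not contained in the commutator
subgroup: the latter centralizes any normal subgroup `W` of order `p ^ 2`, so `A` would have to be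
equal to `W` and to the commutator subgroup, which would then have index `p`. -/
theorem not_le_commutator_of_card_sq (hG : IsPGroup p G) {A : Subgroup G}
    (hA : Nat.card A = p ^ 2) (hc : centralizer (A : Set G) ≤ A) (hAt : A ≠ ⊤) :
    ¬ A ≤ commutator G := by
  intro h
  have hp1 : p ≤ p ^ 2 := Nat.le_self_pow two_ne_zero p
  obtain ⟨W, hWn, hW⟩ := hG.exists_normal_card_sq
    (hA ▸ Nat.le_of_dvd Nat.card_pos (card_subgroup_dvd_card A))
  have hi := hG.index_centralizer_le_of_card_sq W hW
  have h1 : commutator G ≤ centralizer (W : Set G) :=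
    hG.commutator_le_of_index_le_sq _ (hi.trans hp1)
  have h2 : W ≤ A := (le_centralizer_iff.1 (h.trans h1)).trans hc
  obtain rfl : W = A := eq_of_le_of_card_ge h2 (hA.trans hW.symm).le
  have h3 : centralizer (W : Set G) ≤ commutator G := hc.trans h
  have h4 := hG.mul_comm_of_index_commutator_le (by rwa [le_antisymm h1 h3])
  exact hAt (top_unique fun g _ => hc (mem_centralizer_iff.2 fun x _ => h4 x g))

/-- As `|G : G'| ≤ p ^ 2` and `A` is not contained in `G'`, the subgroup `G'H` has index at most
`p`, so `G / H` is generated by one element together with nongenerators. Hence `G / H` is cyclic, and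
`G' ≤ H`. -/
theorem index_le_of_normal_of_card_sq (hG : IsPGroup p G) {A : Subgroup G}
    (hA : Nat.card A = p ^ 2) (hc : centralizer (A : Set G) ≤ A) {H : Subgroup G} [H.Normal]
    (hAH : A ≤ H) : H.index ≤ p := by
  have hone : H = ⊤ → H.index ≤ p := fun h => by rw [h, index_top]; exact hp.out.one_lt.le
  by_cases hAt : A = ⊤
  · exact hone (top_unique (hAt ▸ hAH))
  have hlt : commutator G < commutator G ⊔ H := lt_of_le_of_ne le_sup_left fun he =>
    hG.not_le_commutator_of_card_sq hA hc hAt (he ▸ hAH.trans le_sup_right)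
  have hi : (commutator G ⊔ H).index ≤ p := hG.index_le_of_lt_sq _
    ((index_strictAnti hlt).trans_le (hG.index_commutator_le_sq_of_card_sq hA hc))
  by_cases ht : commutator G ⊔ H = ⊤
  · exact hone (hG.eq_top_of_sup_commutator_eq_top H (by rwa [sup_comm]))
  obtain ⟨x, -, hx⟩ := SetLike.exists_of_lt (lt_top_iff_ne_top.2 ht)
  have hlt2 : commutator G ⊔ H < H ⊔ zpowers x ⊔ commutator G :=
    lt_of_le_of_ne (sup_le le_sup_right (le_sup_left.trans le_sup_left)) fun he => hx (by
      rw [he]; exact mem_sup_left (mem_sup_right (mem_zpowers x)))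
  have h1 : H ⊔ zpowers x = ⊤ := hG.eq_top_of_sup_commutator_eq_top _
    (hG.eq_top_of_index_lt _ ((index_strictAnti hlt2).trans_le hi))
  have h2 : commutator G ≤ H :=
    Subgroup.Normal.commutator_le_of_self_sup_commutative_eq_top h1 inferInstance
  rwa [sup_eq_right.2 h2] at hi

section Nonabelian

variable {X : Subgroup G}

/-- Two noncommuting elements `a` and `b` generate the group `X` of order `p ^ 3`, because its
proper subgroups are abelian. -/
theorem centralizer_inf_le_of_card_cube (hG : IsPGroup p G) (hX : Nat.card X = p ^ 3) {a b : G}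
    (ha : a ∈ X) (hb : b ∈ X) (hab : a * b ≠ b * a) :
    centralizer {a} ⊓ centralizer {b} ≤ centralizer (X : Set G) := by
  intro g hg
  have h1 : X ⊓ centralizer {g} = X := by
    refine eq_of_le_of_card_ge inf_le_left (not_lt.1 fun hlt => hab ?_)
    exact hG.mul_comm_of_mem (hG.card_le_sq_of_lt_cube _ (hX ▸ hlt))
      (show a ∈ X ⊓ centralizer {g} from ⟨ha, mem_centralizer_singleton_iff.2
        (mem_centralizer_singleton_iff.1 hg.1).symm⟩)
      (show b ∈ X ⊓ centralizer {g} from ⟨hb, mem_centralizer_singleton_iff.2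
        (mem_centralizer_singleton_iff.1 hg.2).symm⟩)
  refine mem_centralizer_iff.2 fun x hx => ?_
  rw [← h1] at hx
  exact mem_centralizer_singleton_iff.1 hx.2

theorem card_centralizer_le_of_card_cube (hG : IsPGroup p G) (hX : Nat.card X = p ^ 3) {a b : G}
    (ha : a ∈ X) (hb : b ∈ X) (hab : a * b ≠ b * a) (hc : centralizer (X : Set G) ≤ X) :
    Nat.card (centralizer (X : Set G)) ≤ p := by
  by_contra hlt
  have h1 : p ^ 2 ≤ Nat.card (centralizer (X : Set G)) := by
    by_contra h
    exact hlt (hG.card_le_of_lt_sq _ (not_le.1 h))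
  have haC : a ∉ centralizer (X : Set G) := fun h => hab (mem_centralizer_iff.1 h b hb).symm
  have h2 : centralizer (X : Set G) < X ⊓ centralizer {a} := by
    refine lt_of_le_of_ne (le_inf hc (centralizer_le (Set.singleton_subset_iff.2 ha)))
      fun he => haC ?_
    rw [he]
    exact ⟨ha, mem_centralizer_singleton_iff.2 rfl⟩
  have h3 : X ⊓ centralizer {a} = X := by
    refine eq_of_le_of_card_ge inf_le_left (not_lt.1 fun hl => ?_)
    have h4 := hG.card_le_sq_of_lt_cube _ (hX ▸ hl)
    exact h2.ne (eq_of_le_of_card_ge h2.le (h4.trans h1))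
  rw [← h3] at hb
  exact hab (mem_centralizer_singleton_iff.1 hb.2).symm

theorem card_center_eq_of_card_cube (hG : IsPGroup p G) (hX : Nat.card X = p ^ 3) {a b : G}
    (ha : a ∈ X) (hb : b ∈ X) (hab : a * b ≠ b * a) (hc : centralizer (X : Set G) ≤ X) :
    Nat.card (center G) = p := by
  have : Nontrivial G := ⟨a * b, b * a, hab⟩
  exact le_antisymm ((card_le_of_le (center_le_centralizer _)).trans
    (hG.card_centralizer_le_of_card_cube hX ha hb hab hc)) (hG.le_card_of_ne_bot _ hG.center_ne_bot)

theorem card_map_mk'_center (hG : IsPGroup p G) (hX : Nat.card X = p ^ 3) {a b : G}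
    (ha : a ∈ X) (hb : b ∈ X) (hab : a * b ≠ b * a) (hc : centralizer (X : Set G) ≤ X) :
    Nat.card (X.map (QuotientGroup.mk' (center G))) = p ^ 2 := by
  have h1 := card_comap_mk' (center G) (X.map (QuotientGroup.mk' (center G)))
  rw [comap_map_mk'_of_le _ ((center_le_centralizer _).trans hc),
    hG.card_center_eq_of_card_cube hX ha hb hab hc, hX, pow_succ'] at h1
  exact (Nat.eq_of_mul_eq_mul_left hp.out.pos h1).symm

/-- An element that centralizes `X` modulo the centre moves each of two noncommuting elements of
`X` inside a coset of the centre, of order `p`; so there are at most `p ^ 2 * p` such elements. -/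
theorem centralizer_map_mk'_center_le (hG : IsPGroup p G) (hX : Nat.card X = p ^ 3) {a b : G}
    (ha : a ∈ X) (hb : b ∈ X) (hab : a * b ≠ b * a) (hc : centralizer (X : Set G) ≤ X) :
    centralizer (X.map (QuotientGroup.mk' (center G)) : Set (G ⧸ center G)) ≤
      X.map (QuotientGroup.mk' (center G)) := by
  set π := QuotientGroup.mk' (center G)
  have hZ := hG.card_center_eq_of_card_cube hX ha hb hab hc
  set D := (centralizer (X.map π : Set (G ⧸ center G))).comap π
  have hcard := hG.card_map_mk'_center hX ha hb hab hc
  have hXD : X ≤ D := fun x hx => mem_centralizer_iff.2 fun y hy =>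
    (hG.to_quotient (center G)).mul_comm_of_mem hcard.le hy (mem_map_of_mem π hx)
  have hclass : ∀ x ∈ X, (centralizer {x}).relIndex D ≤ p := fun x hx => by
    have h1 := relIndex_centralizer_le_ncard x D ((fun c => c * x) '' (center G : Set G))
      fun g hg => by
        refine ⟨g * x * g⁻¹ * x⁻¹, ?_, by simp⟩
        have h2 := mem_centralizer_iff.1 hg (π x) (mem_map_of_mem π hx)
        rw [SetLike.mem_coe, ← QuotientGroup.eq_one_iff]
        change π (g * x * g⁻¹ * x⁻¹) = 1
        rw [map_mul, map_mul, map_mul, ← h2, map_inv, map_inv]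
        group
    refine h1.trans ((Set.ncard_image_le (Set.toFinite _)).trans ?_)
    rw [← Nat.card_coe_set_eq]
    exact hZ.le
  have hD : Nat.card D ≤ Nat.card X := by
    have h1 := relIndex_inf_le (H := centralizer {a}) (K := centralizer {b}) (L := D)
    have h2 : Nat.card ((centralizer {a} ⊓ centralizer {b}).subgroupOf D) ≤ p := by
      refine le_trans ?_ (hG.card_centralizer_le_of_card_cube hX ha hb hab hc)
      rw [← inf_subgroupOf_right, card_subgroupOf_of_le inf_le_right]
      exact card_le_of_le (inf_le_left.trans (hG.centralizer_inf_le_of_card_cube hX ha hb hab))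
    have h3 := ((centralizer {a} ⊓ centralizer {b}).subgroupOf D).card_mul_index
    rw [hX, ← h3, pow_succ', sq]
    exact Nat.mul_le_mul h2 (h1.trans (Nat.mul_le_mul (hclass a ha) (hclass b hb)))
  have hDX : X = D := eq_of_le_of_card_ge hXD hD
  intro q hq
  obtain ⟨g, rfl⟩ := QuotientGroup.mk'_surjective _ q
  exact mem_map_of_mem π (hDX ▸ hq : g ∈ X)

/-- A proper self-centralizing nonabelian subgroup `X` of order `p ^ 3` forces a characteristic
subgroup of index `p`, namely the centralizer of the second centre. -/
theorem exists_characteristic_index_eq (hG : IsPGroup p G) (hX : Nat.card X = p ^ 3) {a b : G}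
    (ha : a ∈ X) (hb : b ∈ X) (hab : a * b ≠ b * a) (hc : centralizer (X : Set G) ≤ X)
    (hXt : X ≠ ⊤) : ∃ M : Subgroup G, M.Characteristic ∧ M.index = p := by
  have hZ := hG.card_center_eq_of_card_cube hX ha hb hab hc
  have hA := hG.card_map_mk'_center hX ha hb hab hc
  have hcA := hG.centralizer_map_mk'_center_le hX ha hb hab hc
  have hZX : center G ≤ X := (center_le_centralizer _).trans hc
  set W := (center (G ⧸ center G)).comap (QuotientGroup.mk' (center G)) with hWdef
  have hq := hG.to_quotient (center G)
  have hle : center (G ⧸ center G) ≤ X.map (QuotientGroup.mk' (center G)) :=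
    (center_le_centralizer _).trans hcA
  have hne : center (G ⧸ center G) ≠ X.map (QuotientGroup.mk' (center G)) := by
    intro he
    rw [← he, centralizer_eq_top_iff_subset.2 subset_rfl, he] at hcA
    refine hXt ?_
    rw [← comap_map_mk'_of_le _ hZX, top_le_iff.1 hcA, comap_top]
  have hcZ : Nat.card (center (G ⧸ center G)) = p := by
    have h1 : Nat.card (center (G ⧸ center G)) < p ^ 2 := by
      by_contra h
      exact hne (eq_of_le_of_card_ge hle (hA ▸ not_lt.1 h))
    have : Nontrivial (X.map (QuotientGroup.mk' (center G))) :=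
      Finite.one_lt_card_iff_nontrivial.1 (hA ▸ Nat.one_lt_pow two_ne_zero hp.out.one_lt)
    have : Nontrivial (G ⧸ center G) := Subtype.val_injective.nontrivial
      (α := X.map (QuotientGroup.mk' (center G)))
    exact le_antisymm (hq.card_le_of_lt_sq _ h1) (hq.le_card_of_ne_bot _ hq.center_ne_bot)
  have hW : Nat.card W = p ^ 2 := by rw [card_comap_mk', hZ, hcZ, sq]
  have hWchar : W.Characteristic := Characteristic.comap_quotient_mk centerCharacteristic
  refine ⟨centralizer (W : Set G), inferInstance, le_antisymm
    (hG.index_centralizer_le_of_card_sq W hW) (not_lt.1 fun hlt => ?_)⟩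
  have h1 := hG.eq_top_of_index_lt _ hlt
  rw [centralizer_eq_top_iff_subset] at h1
  have h2 := card_le_of_le (h1 : W ≤ center G)
  rw [hW, hZ] at h2
  have := hp.out.one_lt
  nlinarith

end Nonabelian

end IsPGroup

/-! ### The normalizer tower of a pearl-shaped subgroup -/

namespace Subgroup

theorem le_normalizerTower {G : Type*} [Group G] (Q : Subgroup G) (i : ℕ) :
    Q ≤ normalizerTower Q i := by
  induction i with
  | zero => exact le_rfl
  | succ i ih => exact ih.trans le_normalizer

theorem normalizerTower_mono {G : Type*} [Group G] (Q : Subgroup G) :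
    Monotone (normalizerTower Q) :=
  monotone_nat_of_le_succ fun _ => le_normalizer

/-- `E` contains its centralizer and either has order `p ^ 2`, or is nonabelian of order `p ^ 3`.
This is what the subgroup structure above a pearl depends on. -/
def IsPearlShaped {G : Type*} [Group G] (p : ℕ) (E : Subgroup G) : Prop :=
  centralizer (E : Set G) ≤ E ∧ (Nat.card E = p ^ 2 ∨
    (Nat.card E = p ^ 3 ∧ ∃ a ∈ E, ∃ b ∈ E, a * b ≠ b * a))

namespace IsPearlShaped

open scoped commutatorElement

variable {G : Type*} [Group G] {p : ℕ} {E : Subgroup G}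

theorem subgroupOf (hE : E.IsPearlShaped p) {N : Subgroup G} (h : E ≤ N) :
    (E.subgroupOf N).IsPearlShaped p := by
  refine ⟨centralizer_subgroupOf_le h hE.1, ?_⟩
  rw [card_subgroupOf_of_le h]
  refine hE.2.imp_right fun ⟨h3, a, ha, b, hb, hab⟩ => ⟨h3, ⟨a, h ha⟩, ha, ⟨b, h hb⟩, hb, ?_⟩
  exact fun he => hab (congrArg Subtype.val he)

variable [Finite G] [hp : Fact p.Prime]

theorem index_commutator_le (hE : E.IsPearlShaped p) (hG : IsPGroup p G) :
    (_root_.commutator G).index ≤ p ^ 2 := by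
  obtain ⟨hc, h2 | ⟨h3, a, ha, b, hb, hab⟩⟩ := hE
  · exact hG.index_commutator_le_sq_of_card_sq h2 hc
  · have h := (hG.to_quotient (center G)).index_commutator_le_sq_of_card_sq
      (hG.card_map_mk'_center h3 ha hb hab hc) (hG.centralizer_map_mk'_center_le h3 ha hb hab hc)
    have hne : _root_.commutator G ≠ ⊥ := fun hbot => hab (by
      have : ⁅a, b⁆ ∈ _root_.commutator G := commutator_mem_commutator (mem_top a) (mem_top b)
      rw [hbot, mem_bot] at this
      exact commutatorElement_eq_one_iff_mul_comm.1 this)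
    have hZ : center G ≤ _root_.commutator G := by
      rw [← inf_eq_right]
      refine eq_of_le_of_card_ge inf_le_right ?_
      rw [hG.card_center_eq_of_card_cube h3 ha hb hab hc]
      exact hG.le_card_of_ne_bot _ (hG.inf_center_ne_bot _ hne)
    have hm : _root_.commutator (G ⧸ center G) =
        (_root_.commutator G).map (QuotientGroup.mk' (center G)) := by
      rw [_root_.commutator_def, _root_.commutator_def, map_commutator,
        map_top_of_surjective _ (QuotientGroup.mk'_surjective _)]
    rwa [hm, index_map_eq _ (QuotientGroup.mk'_surjective _)
      (by rwa [QuotientGroup.ker_mk'])] at h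

theorem index_le_of_normal (hE : E.IsPearlShaped p) (hG : IsPGroup p G) {H : Subgroup G}
    [hn : H.Normal] (h : E ≤ H) : H.index ≤ p := by
  obtain ⟨hc, h2 | ⟨h3, a, ha, b, hb, hab⟩⟩ := hE
  · exact hG.index_le_of_normal_of_card_sq h2 hc h
  · have hs := QuotientGroup.mk'_surjective (center G)
    have := hn.map _ hs
    have hi := (hG.to_quotient (center G)).index_le_of_normal_of_card_sq
      (hG.card_map_mk'_center h3 ha hb hab hc) (hG.centralizer_map_mk'_center_le h3 ha hb hab hc)
      (map_mono (f := QuotientGroup.mk' (center G)) h)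
    rwa [index_map_eq _ hs (by
      rw [QuotientGroup.ker_mk']; exact (center_le_centralizer _).trans (hc.trans h))] at hi

theorem relIndex_normalizer_le (hE : E.IsPearlShaped p) (hG : IsPGroup p G) {H : Subgroup G}
    (h : E ≤ H) : H.relIndex (normalizer (H : Set G)) ≤ p := by
  have hl : H ≤ normalizer (H : Set G) := le_normalizer
  exact (hE.subgroupOf (h.trans hl)).index_le_of_normal (hG.to_subgroup _)
    (H := H.subgroupOf (normalizer (H : Set G))) (fun x hx => h hx)

theorem relIndex_normalizer_eq (hE : E.IsPearlShaped p) (hG : IsPGroup p G) {H : Subgroup G}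
    (h : E ≤ H) (hH : H ≠ ⊤) : H.relIndex (normalizer (H : Set G)) = p := by
  refine le_antisymm (hE.relIndex_normalizer_le hG h) (not_lt.1 fun hlt => ?_)
  have := hG.isNilpotent
  have h1 := (hG.to_subgroup _).eq_top_of_index_lt (H.subgroupOf (normalizer (H : Set G))) hlt
  exact (Group.normalizerCondition_of_isNilpotent H (lt_top_iff_ne_top.2 hH)).not_ge
    (subgroupOf_eq_top.1 h1)

theorem card_normalizer_le (hE : E.IsPearlShaped p) (hG : IsPGroup p G) {H : Subgroup G}
    (h : E ≤ H) : Nat.card (normalizer (H : Set G)) ≤ Nat.card H * p := by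
  have hl : H ≤ normalizer (H : Set G) := le_normalizer
  rw [← (H.subgroupOf (normalizer (H : Set G))).card_mul_index, card_subgroupOf_of_le hl]
  exact Nat.mul_le_mul_left _ (hE.relIndex_normalizer_le hG h)

theorem card_normalizer_eq (hE : E.IsPearlShaped p) (hG : IsPGroup p G) {H : Subgroup G}
    (h : E ≤ H) (hH : H ≠ ⊤) : Nat.card (normalizer (H : Set G)) = Nat.card H * p := by
  have hl : H ≤ normalizer (H : Set G) := le_normalizer
  rw [← (H.subgroupOf (normalizer (H : Set G))).card_mul_index, card_subgroupOf_of_le hl]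
  exact congrArg _ (hE.relIndex_normalizer_eq hG h hH)

theorem index_normalizerTower (hE : E.IsPearlShaped p) (hG : IsPGroup p G) {m : ℕ}
    (hm : E.index = p ^ m) {i : ℕ} (hi : i ≤ m) : (normalizerTower E i).index = p ^ (m - i) := by
  induction i with
  | zero => exact hm
  | succ i ih =>
    have ih := ih (by omega)
    have hne : normalizerTower E i ≠ ⊤ := fun ht => by
      rw [ht, index_top] at ih
      exact (Nat.one_lt_pow (by omega) hp.out.one_lt).ne ih
    have h1 := relIndex_mul_index (le_normalizer (H := normalizerTower E i))
    rw [hE.relIndex_normalizer_eq hG (le_normalizerTower E i) hne, ih,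
      show m - i = (m - (i + 1)) + 1 by omega, pow_succ'] at h1
    exact Nat.eq_of_mul_eq_mul_left hp.out.pos h1

theorem normalizerTower_eq_top_iff (hE : E.IsPearlShaped p) (hG : IsPGroup p G) {m : ℕ}
    (hm : E.index = p ^ m) {i : ℕ} (hi : i ≤ m) : normalizerTower E i = ⊤ ↔ i = m := by
  rw [← index_eq_one, hE.index_normalizerTower hG hm hi, Nat.pow_eq_one]
  have := hp.out.one_lt
  omega

theorem relIndex_normalizerTower_succ (hE : E.IsPearlShaped p) (hG : IsPGroup p G) {m : ℕ}
    (hm : E.index = p ^ m) {i : ℕ} (hi : i + 1 ≤ m) :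
    (normalizerTower E i).relIndex (normalizerTower E (i + 1)) = p :=
  hE.relIndex_normalizer_eq hG (le_normalizerTower E i) fun h => by
    have := (hE.normalizerTower_eq_top_iff hG hm (by omega)).1 h
    omega

theorem hasMaximalNormalizerTower (hE : E.IsPearlShaped p) (hG : IsPGroup p G) {m : ℕ}
    (hm : E.index = p ^ m) : HasMaximalNormalizerTower p m E := by
  refine ⟨(hE.normalizerTower_eq_top_iff hG hm le_rfl).2 rfl, fun i h1 hi => ?_⟩
  obtain ⟨i, rfl⟩ := Nat.exists_eq_add_of_le' h1
  exact hE.relIndex_normalizerTower_succ hG hm hi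

/-- If `N^i(E) < H`, then `H` contains an element normalizing `N^i(E)` outside `N^i(E)`, and thus
`N^(i+1)(E)`, because the index of `N^i(E)` there is prime. -/
theorem le_iff_exists_eq_normalizerTower (hE : E.IsPearlShaped p) (hG : IsPGroup p G) {m : ℕ}
    (hm : E.index = p ^ m) (H : Subgroup G) : E ≤ H ↔ ∃ i ≤ m, H = normalizerTower E i := by
  refine ⟨fun h => ?_, fun ⟨i, _, hi⟩ => hi ▸ le_normalizerTower E i⟩
  by_contra! hno
  have hall : ∀ i ≤ m, normalizerTower E i ≤ H := by
    intro i
    induction i with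
    | zero => exact fun _ => h
    | succ i ih =>
      intro hi
      have ih := ih (by omega)
      have hlt : (normalizerTower E i).subgroupOf H < ⊤ := lt_top_iff_ne_top.2 fun ht =>
        hno i (by omega) (le_antisymm (subgroupOf_eq_top.1 ht) ih)
      have := (hG.to_subgroup H).isNilpotent
      obtain ⟨x, hx, hxn⟩ := SetLike.exists_of_lt
        (Group.normalizerCondition_of_isNilpotent _ hlt)
      have hxN : (x : G) ∈ normalizerTower E (i + 1) := by
        rw [mem_normalizer_iff] at hx
        refine mem_normalizer_iff.2 fun y => ⟨fun hy => (hx ⟨y, ih hy⟩).1 hy, fun hy => ?_⟩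
        have hyH : y ∈ H := by
          have := H.mul_mem (H.mul_mem (H.inv_mem x.2) (ih hy)) x.2
          simpa [mul_assoc] using this
        exact (hx ⟨y, hyH⟩).2 hy
      have hlt2 : (normalizerTower E i).subgroupOf (normalizerTower E (i + 1)) <
          H.subgroupOf (normalizerTower E (i + 1)) :=
        lt_of_le_of_ne (fun y hy => ih hy) fun he => hxn (by
          have : (⟨x, hxN⟩ : normalizerTower E (i + 1)) ∈
            H.subgroupOf (normalizerTower E (i + 1)) := x.2
          rw [← he] at this
          exact this)
      have h1 := (hG.to_subgroup _).eq_top_of_index_lt _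
        ((index_strictAnti hlt2).trans_le (hE.relIndex_normalizerTower_succ hG hm hi).le)
      exact subgroupOf_eq_top.1 h1
  refine hno m le_rfl ?_
  have := hall m le_rfl
  rw [(hE.normalizerTower_eq_top_iff hG hm le_rfl).2 rfl] at this ⊢
  exact top_unique this

end IsPearlShaped

end Subgroup

/-! ### Automorphism groups with an invariant maximal subgroup -/

section FixedPoints

variable {α : Type*} [Finite α] {p : ℕ} [hp : Fact p.Prime]

theorem Function.card_modEq_ncard_fixedPoints (f : α → α) {n : ℕ} (hf : f^[p ^ n] = id) :
    Nat.card α ≡ (Function.fixedPoints f).ncard [MOD p] := by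
  classical
  have := Fintype.ofFinite α
  have hpow : ∀ k : ℕ, (show Function.End α from f) ^ k = (f^[k] : α → α) := by
    intro k
    induction k with
    | zero => rfl
    | succ k ih => rw [pow_succ, ih]; rfl
  have h := Equiv.Perm.card_fixedPoints_modEq (f := (show Function.End α from f)) (p := p) (n := n)
    (by rw [hpow, hf]; rfl)
  rwa [← Nat.card_eq_fintype_card, ← Nat.card_eq_fintype_card, Nat.card_coe_set_eq] at h

theorem Function.eq_of_card_eq_prime (hα : Nat.card α = p) (f : α → α) {n : ℕ}
    (hf : f^[p ^ n] = id) {a : α} (ha : f a = a) (x : α) : f x = x := by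
  have h1 := Function.card_modEq_ncard_fixedPoints f hf
  have h2 : 0 < (Function.fixedPoints f).ncard := (Set.ncard_pos (Set.toFinite _)).2 ⟨a, ha⟩
  have h3 : p ∣ (Function.fixedPoints f).ncard :=
    (Nat.modEq_zero_iff_dvd).1 (h1.symm.trans (by
      rw [hα]; exact (Nat.modEq_zero_iff_dvd).2 dvd_rfl))
  have h4 := Set.eq_of_subset_of_ncard_le (Set.subset_univ (Function.fixedPoints f))
    (by rw [Set.ncard_univ, hα]; exact Nat.le_of_dvd h2 h3)
  exact (h4 ▸ Set.mem_univ x : x ∈ Function.fixedPoints f)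

end FixedPoints

theorem Subgroup.Characteristic.apply_mem {G : Type*} [Group G] {H : Subgroup G}
    (hH : H.Characteristic) (α : MulAut G) {x : G} (hx : x ∈ H) : α x ∈ H := by
  rw [← hH.fixed α] at hx
  exact hx

namespace IsPGroup

open Subgroup

variable {P : Type*} [Group P] [Finite P] {p : ℕ} [hp : Fact p.Prime]

/-- An endomorphism of `p`-power order acts trivially on an invariant section of order at most
`p`. -/
theorem inv_mul_mem_of_index_le (hP : IsPGroup p P) (M : Subgroup P) [M.Normal] (hM : M.index ≤ p)
    (f : P →* P) {n : ℕ} (hf : f^[p ^ n] = id) (hfM : ∀ x ∈ M, f x ∈ M) (x : P) :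
    x⁻¹ * f x ∈ M := by
  rcases hM.lt_or_eq with h | h
  · rw [hP.eq_top_of_index_lt M h]; exact mem_top _
  rw [index_eq_card] at h
  let g : P ⧸ M →* P ⧸ M := QuotientGroup.map M M f hfM
  have hs : Function.Semiconj (QuotientGroup.mk : P → P ⧸ M) f g := fun y => rfl
  have hg : g^[p ^ n] = id := by
    funext q
    obtain ⟨y, rfl⟩ := QuotientGroup.mk_surjective q
    rw [← hs.iterate_right, hf]
    rfl
  have h1 := Function.eq_of_card_eq_prime h g hg (map_one g) (x : P ⧸ M)
  exact QuotientGroup.eq.1 h1.symm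

/-- An automorphism of prime order different from `p` that acts trivially on `P / M` and on
`M / P'` is trivial: it has a fixed point in each coset of `M` and, inside `M`, in each coset of
`P'`, so its fixed points generate `P` modulo `P'`. -/
theorem mulAut_eq_one_of_pow_eq_one (hP : IsPGroup p P) (M : Subgroup P) (α : MulAut P)
    (h1 : ∀ x, x⁻¹ * α x ∈ M) (h2 : ∀ x ∈ M, x⁻¹ * α x ∈ commutator P) {q : ℕ}
    (hq : q.Prime) (hqp : q ≠ p) (hα : α ^ q = 1) : α = 1 := by
  have := Fact.mk hq
  have key : ∀ (K : Subgroup P), (∀ x ∈ K, α x ∈ K) → ∀ x, x⁻¹ * α x ∈ K →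
      ∃ y, α y = y ∧ x⁻¹ * y ∈ K := by
    intro K hK x hx
    have hmaps : ∀ y, x⁻¹ * y ∈ K → x⁻¹ * α y ∈ K := fun y hy => by
      have := K.mul_mem hx (hK _ hy)
      rwa [map_mul, map_inv, mul_assoc, mul_inv_cancel_left] at this
    let f : {y // x⁻¹ * y ∈ K} → {y // x⁻¹ * y ∈ K} := fun y => ⟨α y, hmaps y y.2⟩
    have hs : Function.Semiconj (Subtype.val : {y // x⁻¹ * y ∈ K} → P) f α := fun y => rfl
    have hf : f^[q ^ 1] = id := by
      funext y
      apply Subtype.ext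
      rw [hs.iterate_right, pow_one]
      have : (⇑α)^[q] = ⇑(α ^ q) := by
        exact (hom_coe_pow (fun g : MulAut P => (g : P → P)) rfl (fun _ _ => rfl) α q).symm
      rw [this, hα]
      rfl
    have hc := Function.card_modEq_ncard_fixedPoints f hf
    have hcard : Nat.card {y // x⁻¹ * y ∈ K} = Nat.card K :=
      Nat.card_congr ⟨fun y => ⟨x⁻¹ * y, y.2⟩, fun k => ⟨x * k, by simp⟩, fun y => by simp,
        fun k => by simp⟩
    have hne : (Function.fixedPoints f).Nonempty := by
      rw [Set.nonempty_iff_ne_empty]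
      intro he
      rw [he, Set.ncard_empty, hcard] at hc
      obtain ⟨n, hn⟩ := IsPGroup.iff_card.1 (hP.to_subgroup K)
      rw [hn] at hc
      exact hqp ((Nat.prime_dvd_prime_iff_eq hq hp.out).1
        (hq.dvd_of_dvd_pow ((Nat.modEq_zero_iff_dvd).1 hc)))
    obtain ⟨y, hy⟩ := hne
    exact ⟨y, congrArg Subtype.val hy, y.2⟩
  let C : Subgroup P := (α : P →* P).eqLocus (MonoidHom.id P)
  have hMc : ∀ x ∈ M, α x ∈ M := fun x hx => by
    have := M.mul_mem hx (h1 x)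
    rwa [mul_inv_cancel_left] at this
  have hcc : ∀ x ∈ commutator P, α x ∈ commutator P := fun x hx =>
    Characteristic.apply_mem inferInstance α hx
  have hC : C ⊔ commutator P = ⊤ := by
    refine top_unique fun x _ => ?_
    obtain ⟨y, hy, hxy⟩ := key M hMc x (h1 x)
    obtain ⟨z, hz, hz'⟩ := key _ hcc (x⁻¹ * y) (h2 _ hxy)
    have e : x = y * ((x⁻¹ * y)⁻¹ * z) * z⁻¹ := by group
    rw [e]
    exact mul_mem (mul_mem (mem_sup_left hy) (mem_sup_right hz'))
      (inv_mem (mem_sup_left (show z ∈ C from hz)))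
  have := hP.eq_top_of_sup_commutator_eq_top C hC
  ext x
  exact (this ▸ mem_top x : x ∈ C)

/-- If a group `A` of automorphisms of a finite `p`-group `P` with `|P : P'| ≤ p ^ 2` leaves a
subgroup `M` of index `p` invariant, then the automorphisms in `A` that act trivially on `P / M` and
on `M / P'` form a normal `p`-subgroup containing all `p`-subgroups of `A`. -/
theorem sylow_mulAut_normal (hP : IsPGroup p P) (hc : (commutator P).index ≤ p ^ 2)
    (M : Subgroup P) (hM : M.index = p) (A : Subgroup (MulAut P))
    (hAM : ∀ α ∈ A, ∀ x ∈ M, α x ∈ M) (T : Sylow p A) : (T : Subgroup A).Normal := by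
  have := hP.isNilpotent
  have hMn : M.Normal := by
    refine normal_of_index_eq_minFac_card ?_
    obtain ⟨n, hn⟩ := IsPGroup.iff_card.1 hP
    have hn0 : n ≠ 0 := fun h0 => hp.out.one_lt.not_ge (by
      have := Nat.le_of_dvd Nat.card_pos M.index_dvd_card
      rwa [hM, hn, h0, pow_zero] at this)
    rw [hM, hn, hp.out.pow_minFac hn0]
  have hcM : commutator P ≤ M := hP.commutator_le_of_index_le_sq M
    (hM.trans_le (Nat.le_self_pow two_ne_zero p))
  have hcc : ∀ α : MulAut P, ∀ x ∈ commutator P, α x ∈ commutator P := fun α x hx =>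
    Characteristic.apply_mem inferInstance α hx
  have hrel : (commutator P).relIndex M ≤ p := by
    have h1 := relIndex_mul_index hcM
    rw [hM] at h1
    rw [← h1, sq] at hc
    exact Nat.le_of_mul_le_mul_right hc hp.out.pos
  let B : Subgroup A :=
    { carrier := {α | (∀ x, x⁻¹ * (α : MulAut P) x ∈ M) ∧
        ∀ x ∈ M, x⁻¹ * (α : MulAut P) x ∈ commutator P}
      one_mem' := ⟨fun x => by simp, fun x _ => by simp⟩
      mul_mem' := by
        intro α β hα hβ
        have e : ∀ x, x⁻¹ * ((α * β : A) : MulAut P) x = x⁻¹ * (β : MulAut P) x *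
            (((β : MulAut P) x)⁻¹ * (α : MulAut P) ((β : MulAut P) x)) := fun x => by
          simp [mul_assoc]
        exact ⟨fun x => e x ▸ mul_mem (hβ.1 x) (hα.1 _),
          fun x hx => e x ▸ mul_mem (hβ.2 x hx) (hα.2 _ (hAM _ β.2 x hx))⟩
      inv_mem' := by
        intro α hα
        have e : ∀ x, x⁻¹ * ((α⁻¹ : A) : MulAut P) x =
            ((((α⁻¹ : A) : MulAut P) x)⁻¹ * (α : MulAut P) (((α⁻¹ : A) : MulAut P) x))⁻¹ :=
          fun x => by simp
        exact ⟨fun x => e x ▸ inv_mem (hα.1 _),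
          fun x hx => e x ▸ inv_mem (hα.2 _ (hAM _ (α⁻¹).2 x hx))⟩ }
  have hBn : B.Normal := ⟨fun α hα β => by
    have e : ∀ x, x⁻¹ * ((β * α * β⁻¹ : A) : MulAut P) x = (β : MulAut P)
        ((((β⁻¹ : A) : MulAut P) x)⁻¹ * (α : MulAut P) (((β⁻¹ : A) : MulAut P) x)) :=
      fun x => by simp
    exact ⟨fun x => e x ▸ hAM _ β.2 _ (hα.1 _),
      fun x hx => e x ▸ hcc _ _ (hα.2 _ (hAM _ (β⁻¹).2 x hx))⟩⟩
  have hBp : IsPGroup p B := by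
    rw [isPGroup_iff_primeFactors_card_subset hp.out.ne_zero]
    intro q hq
    by_contra hqp
    rw [hp.out.primeFactors, Finset.mem_singleton] at hqp
    have hq' := Nat.prime_of_mem_primeFactors hq
    have := Fact.mk hq'
    obtain ⟨α, hα⟩ := exists_prime_orderOf_dvd_card' q (Nat.dvd_of_mem_primeFactors hq)
    have h1 := hP.mulAut_eq_one_of_pow_eq_one M (α : A) α.2.1 α.2.2 hq' hqp (by
      have := pow_orderOf_eq_one α
      rw [hα] at this
      exact_mod_cast congrArg (fun β : B => ((β : A) : MulAut P)) this)
    have h2 : α = 1 := Subtype.ext (Subtype.ext h1)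
    rw [h2, orderOf_one] at hα
    exact hq'.one_lt.ne hα
  have hTB : (T : Subgroup A) ≤ B := by
    intro α hα
    obtain ⟨n, hn⟩ := T.isPGroup' ⟨α, hα⟩
    have hn' : (α : MulAut P) ^ p ^ n = 1 := by
      have := congrArg (fun β : (T : Subgroup A) => ((β : A) : MulAut P)) hn
      simpa only [SubgroupClass.coe_pow, OneMemClass.coe_one] using this
    have hit : (⇑(α : MulAut P))^[p ^ n] = id := by
      have h3 := hom_coe_pow (fun g : MulAut P => (g : P → P)) rfl (fun _ _ => rfl)
        (α : MulAut P) (p ^ n)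
      rw [← h3, hn']
      rfl
    refine ⟨hP.inv_mul_mem_of_index_le M hM.le ((α : MulAut P) : P →* P) hit (hAM _ α.2),
      fun x hx => ?_⟩
    let f : M →* M := (((α : MulAut P) : P →* P).comp M.subtype).codRestrict M
      fun y => hAM _ α.2 y y.2
    have hs : Function.Semiconj (Subtype.val : M → P) f (α : MulAut P) := fun y => rfl
    have hf : f^[p ^ n] = id := by
      funext y
      apply Subtype.ext
      rw [hs.iterate_right, hit]
      rfl
    exact (hP.to_subgroup M).inv_mul_mem_of_index_le ((commutator P).subgroupOf M) hrel f hf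
      (fun y hy => hcc _ _ hy) ⟨x, hx⟩
  rw [← T.is_maximal' hBp hTB]
  exact hBn

end IsPGroup

/-! ### Strongly `p`-embedded subgroups -/

open Subgroup in
/-- A group with a strongly `p`-embedded subgroup `H` has no nontrivial normal `p`-subgroup `N`:
an element of order `p` of `H` centralizes some nontrivial element of `N`, which then lies in `H`;
as `N` satisfies the normalizer condition, it follows that `N ≤ H`, and so `N` lies in each
conjugate of `H`. -/
theorem IsStronglyEmbedded.eq_bot_of_normal {G : Type*} [Group G] [Finite G] {p : ℕ}
    [hp : Fact p.Prime] {H : Subgroup G} (hH : IsStronglyEmbedded p H) (N : Subgroup G)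
    [hN : N.Normal] (hNp : IsPGroup p N) : N = ⊥ := by
  by_contra hbot
  obtain ⟨hHt, hpH, hemb⟩ := hH
  have hmemH : ∀ (K : Subgroup G) (x : G), p ∣ Nat.card K → K ≤ H →
      (∀ k ∈ K, x⁻¹ * k * x ∈ H) → x ∈ H := by
    intro K x hK hKH hconj
    by_contra hx
    refine hemb x hx (hK.trans (card_dvd_of_le (le_inf hKH fun k hk => ?_)))
    exact ⟨x⁻¹ * k * x, hconj k hk, by simp [mul_assoc]⟩
  have hdvd : ∀ K : Subgroup G, K ≤ N → K ≠ ⊥ → p ∣ Nat.card K := fun K hK hK' =>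
    ((hNp.to_le hK).card_eq_or_dvd).resolve_left fun h => hK' (Subgroup.card_eq_one.1 h)
  obtain ⟨y, hy⟩ := exists_prime_orderOf_dvd_card' p hpH
  have hyo : orderOf (y : G) = p := by rw [← hy, Subgroup.orderOf_coe]
  have hyp : IsPGroup p (zpowers (y : G)) :=
    IsPGroup.of_card (n := 1) (by rw [Nat.card_zpowers, hyo, pow_one])
  have hYp : IsPGroup p (zpowers (y : G) ⊔ N : Subgroup G) := hyp.to_sup_of_normal_right hNp
  have hne : N.subgroupOf (zpowers (y : G) ⊔ N) ≠ ⊥ := fun h => hbot (by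
    rw [subgroupOf_eq_bot] at h
    exact disjoint_self.1 (h.mono_right le_sup_right))
  obtain ⟨⟨x, hxN, hxZ⟩, hx⟩ := Subgroup.ne_bot_iff_exists_ne_one.1 (hYp.inf_center_ne_bot _ hne)
  have hx1 : x ≠ 1 := fun h => hx (Subtype.ext h)
  have hxy : (y : G) * x = x * y := congrArg Subtype.val
    (mem_center_iff.1 hxZ ⟨y, mem_sup_left (mem_zpowers _)⟩)
  have hxH : (x : G) ∈ H := by
    refine hmemH (zpowers (y : G)) x (by rw [Nat.card_zpowers, hyo]) (zpowers_le.2 y.2) ?_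
    intro k hk
    obtain ⟨i, rfl⟩ := mem_zpowers_iff.1 hk
    have : Commute ((y : G) ^ i) x := (show Commute (y : G) x from hxy).zpow_left i
    rw [mul_assoc, this.eq, inv_mul_cancel_left]
    exact zpow_mem y.2 i
  have hK : N ⊓ H ≠ ⊥ := fun h => hx1 (Subtype.ext (mem_bot.1 (h ▸ ⟨hxN, hxH⟩)))
  have hNH : N ≤ H := by
    by_contra hnot
    have hlt : H.subgroupOf N < ⊤ := lt_top_iff_ne_top.2 fun h => hnot (subgroupOf_eq_top.1 h)
    have := hNp.isNilpotent
    obtain ⟨n, hn, hnH⟩ := SetLike.exists_of_lt (Group.normalizerCondition_of_isNilpotent _ hlt)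
    refine hnH (hmemH (N ⊓ H) n (hdvd _ inf_le_left hK) inf_le_right fun k hk => ?_)
    have := (mem_normalizer_iff.1 (inv_mem hn) ⟨k, hk.1⟩).1 hk.2
    rw [inv_inv] at this
    exact this
  refine hHt (top_unique fun g _ => hmemH N g (hdvd N le_rfl hbot) hNH fun k hk => hNH ?_)
  simpa using hN.conj_mem k hk g⁻¹

/-! ### Saturated fusion systems: full automization and extension of automorphisms -/

namespace FusionSystem

open Subgroup

variable {S : Type u} [Group S] (F : FusionSystem S)

theorem inclusion_mem {P Q : Subgroup S} (h : P ≤ Q) : Subgroup.inclusion h ∈ F.hom P Q :=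
  F.conj_mem _ 1 fun x => by simp

variable {F}

theorem symm_mem {P Q : Subgroup S} {e : P ≃* Q} (he : e.toMonoidHom ∈ F.hom P Q) :
    e.symm.toMonoidHom ∈ F.hom Q P :=
  (F.iso_mem e he fun _ => rfl).2

theorem card_image {P Q : Subgroup S} {φ : P →* Q} (hφ : φ ∈ F.hom P Q) :
    Nat.card (image φ) = Nat.card P :=
  (Nat.card_congr (MonoidHom.ofInjective
    (f := Q.subtype.comp φ) (Q.subtype_injective.comp (F.injective_of_mem hφ))).toEquiv).symm

theorem isPearlShaped_image {p : ℕ} {E : Subgroup S} (hE : E.IsPearlShaped p)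
    (hc : F.IsCentric E) {α : E →* (⊤ : Subgroup S)} (hα : α ∈ F.hom E ⊤) :
    (image α).IsPearlShaped p := by
  refine ⟨hc α hα, ?_⟩
  rw [card_image hα]
  refine hE.2.imp_right fun ⟨h3, a, ha, b, hb, hab⟩ =>
    ⟨h3, _, ⟨⟨a, ha⟩, rfl⟩, _, ⟨⟨b, hb⟩, rfl⟩, fun he => hab ?_⟩
  rw [← map_mul, ← map_mul] at he
  exact congrArg Subtype.val
    (((⊤ : Subgroup S).subtype_injective.comp (F.injective_of_mem hα)) he)

theorem IsPearl.isPearlShaped {p : ℕ} {E : Subgroup S} (hE : F.IsPearl p E) :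
    E.IsPearlShaped p := by
  obtain ⟨⟨hc, -, -⟩, h⟩ := hE
  refine ⟨?_, h.imp (fun h => h.1) fun ⟨h3, hab⟩ => ⟨h3, ?_⟩⟩
  · have := hc _ (F.inclusion_mem le_top)
    have hi : image (Subgroup.inclusion (le_top : E ≤ ⊤)) = E := by
      ext x
      exact ⟨fun ⟨y, hy⟩ => hy ▸ y.2, fun hx => ⟨⟨x, hx⟩, rfl⟩⟩
    rwa [hi] at this
  · push Not at hab
    obtain ⟨a, b, hab⟩ := hab
    exact ⟨a, a.2, b, b.2, fun h => hab (Subtype.ext h)⟩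

theorem congr_mem_aut {P Q : Subgroup S} {e : P ≃* Q} (he : e.toMonoidHom ∈ F.hom P Q)
    {φ : MulAut P} (hφ : φ ∈ F.aut P) : MulAut.congr e φ ∈ F.aut Q :=
  F.comp_mem (symm_mem he) (F.comp_mem hφ he)

theorem isPGroup_autS {p : ℕ} (hS : IsPGroup p S) (P : Subgroup S) : IsPGroup p (autS P) :=
  (hS.to_subgroup _).of_surjective P.normalizerMonoidHom.rangeRestrict
    P.normalizerMonoidHom.rangeRestrict_surjective

variable [Finite S]

/-- Above a pearl, each subgroup has maximal normalizer order among its conjugates: the conjugates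
contain conjugates of the pearl, which bound the index in the normalizer by `p`. -/
theorem card_normalizer_le_of_isConj {p : ℕ} [hp : Fact p.Prime] (hS : IsPGroup p S)
    {E P Q : Subgroup S} (hE : E.IsPearlShaped p) (hc : F.IsCentric E) (hEP : E ≤ P)
    (hPQ : F.IsConj P Q) :
    Nat.card (normalizer (Q : Set S)) ≤ Nat.card (normalizer (P : Set S)) := by
  obtain ⟨e, he⟩ := hPQ
  by_cases hP : P = ⊤
  · rw [hP]
    exact card_le_of_le (le_top.trans le_normalizer)
  have h1 := isPearlShaped_image hE hc
    (F.comp_mem (F.comp_mem (F.inclusion_mem hEP) he) (F.inclusion_mem (le_top (a := Q))))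
  rw [hE.card_normalizer_eq hS hEP hP, Nat.card_congr e.toEquiv]
  refine h1.card_normalizer_le hS ?_
  rintro _ ⟨y, rfl⟩
  exact (e _).2

/-- An isomorphism `e : P ≃* Q` of the fusion system that carries `Aut_S(P)` into `Aut_S(Q)`, where
`Q` is receptive and its normalizer is not larger than that of `P`, extends to an isomorphism of
the normalizers. -/
theorem IsReceptive.exists_normalizer_equiv {P Q : Subgroup S} (hQ : F.IsReceptive Q) (e : P ≃* Q)
    (he : e.toMonoidHom ∈ F.hom P Q) (haut : ∀ g ∈ autS P, MulAut.congr e g ∈ autS Q)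
    (hcard : Nat.card (normalizer (Q : Set S)) ≤ Nat.card (normalizer (P : Set S))) :
    ∃ f : normalizer (P : Set S) ≃* normalizer (Q : Set S), f.toMonoidHom ∈ F.hom _ _ ∧
      ∀ x : P, (f ⟨x, le_normalizer x.2⟩ : S) = e x := by
  obtain ⟨ψ, hψ, hψe⟩ := hQ P e he
  have hN : normalizer (P : Set S) ≤ extender e := fun g hg =>
    ⟨⟨g, hg⟩, haut _ ⟨⟨g, hg⟩, rfl⟩, rfl⟩
  set χ := ψ.comp (Subgroup.inclusion hN) with hχdef
  have hχ : χ ∈ F.hom (normalizer (P : Set S)) ⊤ := F.comp_mem (F.inclusion_mem hN) hψ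
  have hχe : ∀ x : P, (χ ⟨x, le_normalizer x.2⟩ : S) = e x := fun x => hψe x _
  have hconj : ∀ (g : normalizer (P : Set S)) (y : S), y ∈ Q →
      (χ g : S) * y * (χ g : S)⁻¹ ∈ Q := by
    intro g y hy
    obtain ⟨x, hx⟩ := e.surjective ⟨y, hy⟩
    have h1 : (y : S) = χ ⟨x, le_normalizer x.2⟩ := by rw [hχe, hx]
    have h2 := hχe ⟨g * x * (g : S)⁻¹, (mem_normalizer_iff.1 g.2 x).1 x.2⟩
    have h3 : (⟨g * x * (g : S)⁻¹, le_normalizer ((mem_normalizer_iff.1 g.2 x).1 x.2)⟩ :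
        normalizer (P : Set S)) = g * ⟨x, le_normalizer x.2⟩ * g⁻¹ := rfl
    rw [h3, map_mul, map_mul, map_inv] at h2
    rw [h1]
    have h4 := (e ⟨g * x * (g : S)⁻¹, (mem_normalizer_iff.1 g.2 x).1 x.2⟩).2
    rw [← h2] at h4
    exact h4
  have hmem : ∀ g : normalizer (P : Set S), (χ g : S) ∈ normalizer (Q : Set S) := by
    intro g
    refine mem_normalizer_iff.2 fun y => ⟨hconj g y, fun hy => ?_⟩
    have := hconj g⁻¹ _ hy
    simpa [mul_assoc] using this
  let f : normalizer (P : Set S) →* normalizer (Q : Set S) :=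
    ((⊤ : Subgroup S).subtype.comp χ).codRestrict _ hmem
  have hf : Function.Injective f := fun a b hab =>
    F.injective_of_mem hχ (Subtype.ext (congrArg (fun y : normalizer (Q : Set S) => (y : S)) hab))
  have hbij := hf.bijective_of_nat_card_le hcard
  exact ⟨MulEquiv.ofBijective f hbij, (F.iso_mem _ hχ fun _ => rfl).1, hχe⟩

/-- By Sylow's theorem in `Aut_F(Q)`, an isomorphism onto a fully automized receptive conjugate can
be chosen to carry `Aut_S(P)` into `Aut_S(Q)`. -/
theorem IsSaturated.exists_equiv {p : ℕ} [hp : Fact p.Prime] (hF : F.IsSaturated p)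
    (hS : IsPGroup p S) (P : Subgroup S) :
    ∃ (Q : Subgroup S) (e : P ≃* Q), e.toMonoidHom ∈ F.hom P Q ∧ F.IsFullyAutomized p Q ∧
      F.IsReceptive Q ∧ ∀ g ∈ autS P, MulAut.congr e g ∈ autS Q := by
  obtain ⟨Q, ⟨e, he⟩, ⟨T, hT⟩, hrec⟩ := hF P
  have hU : IsPGroup p (((autS P).map (MulAut.congr e).toMonoidHom).subgroupOf (F.aut Q)) :=
    ((isPGroup_autS hS P).map _).comap_subtype
  obtain ⟨T', hT'⟩ := hU.exists_le_sylow
  obtain ⟨c, hc⟩ := MulAction.exists_smul_eq (F.aut Q) T' T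
  refine ⟨Q, e.trans (c : MulAut Q), F.comp_mem he c.2, ⟨T, hT⟩, hrec, fun g hg => ?_⟩
  have h1 : (⟨MulAut.congr e g, congr_mem_aut he (F.autS_le_aut P hg)⟩ : F.aut Q) ∈
      (T' : Subgroup (F.aut Q)) := hT' ⟨g, hg, rfl⟩
  have h2 : c * ⟨MulAut.congr e g, congr_mem_aut he (F.autS_le_aut P hg)⟩ * c⁻¹ ∈
      (T : Subgroup (F.aut Q)) := by
    rw [← hc, Sylow.coe_subgroup_smul]
    exact ⟨_, h1, rfl⟩
  rw [hT] at h2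
  exact h2

theorem IsSaturated.isFullyAutomized {p : ℕ} [hp : Fact p.Prime] (hF : F.IsSaturated p)
    (hS : IsPGroup p S) {P : Subgroup S} (hP : ∀ Q, F.IsConj P Q →
      Nat.card (normalizer (Q : Set S)) ≤ Nat.card (normalizer (P : Set S))) :
    F.IsFullyAutomized p P := by
  obtain ⟨Q, e, he, ⟨T, hT⟩, hrec, haut⟩ := hF.exists_equiv hS P
  obtain ⟨f, -, hf⟩ := hrec.exists_normalizer_equiv e he haut (hP Q ⟨e, he⟩)
  have h1 : (F.aut P).map (MulAut.congr e).toMonoidHom = F.aut Q := by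
    refine le_antisymm ?_ fun φ hφ => ⟨MulAut.congr e.symm φ, congr_mem_aut (symm_mem he) hφ, ?_⟩
    · rintro _ ⟨φ, hφ, rfl⟩
      exact congr_mem_aut he hφ
    · ext x
      simp
  have h2 : (autS P).map (MulAut.congr e).toMonoidHom = autS Q := by
    refine le_antisymm ?_ ?_
    · rintro _ ⟨φ, hφ, rfl⟩
      exact haut φ hφ
    · rintro _ ⟨y, rfl⟩
      refine ⟨P.normalizerMonoidHom (f.symm y), ⟨_, rfl⟩, ?_⟩
      ext q
      have h3 := hf (P.normalizerMonoidHom (f.symm y) (e.symm q))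
      have h4 := hf (e.symm q)
      rw [e.apply_symm_apply] at h4
      refine h3.symm.trans ?_
      have h5 : (⟨P.normalizerMonoidHom (f.symm y) (e.symm q), le_normalizer (Subtype.mem _)⟩ :
          normalizer (P : Set S)) = f.symm y * ⟨e.symm q, le_normalizer (Subtype.mem _)⟩ *
            (f.symm y)⁻¹ := rfl
      rw [h5, map_mul, map_mul, map_inv, f.apply_symm_apply]
      push_cast
      rw [h4]
      rfl
  have hinj : Function.Injective (MulAut.congr e).toMonoidHom := (MulAut.congr e).injective
  have hc1 : Nat.card (F.aut Q) = Nat.card (F.aut P) := by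
    rw [← h1, card_map_of_injective hinj]
  have hc2 : Nat.card (autS Q) = Nat.card (autS P) := by
    rw [← h2, card_map_of_injective hinj]
  have hc3 : Nat.card ((autS P).subgroupOf (F.aut P)) =
      p ^ (Nat.card (F.aut P)).factorization p := by
    rw [card_subgroupOf_of_le (F.autS_le_aut P), ← hc2, ← hc1, ← T.card_eq_multiplicity, hT,
      card_subgroupOf_of_le (F.autS_le_aut Q)]
  exact ⟨Sylow.ofCard _ hc3, rfl⟩

/-- An automorphism `φ` that normalizes `Aut_S(P)` is extended by comparing the extensions of `e`
and `e ∘ φ`, where `e` is an isomorphism onto a receptive conjugate. -/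
theorem IsSaturated.exists_extension {p : ℕ} [hp : Fact p.Prime] (hF : F.IsSaturated p)
    (hS : IsPGroup p S) {P : Subgroup S} (hP : ∀ Q, F.IsConj P Q →
      Nat.card (normalizer (Q : Set S)) ≤ Nat.card (normalizer (P : Set S)))
    {φ : MulAut P} (hφ : φ ∈ F.aut P) (hn : φ ∈ normalizer (autS P : Set (MulAut P))) :
    ∃ ψ ∈ F.aut (normalizer (P : Set S)), ∀ x : P, (ψ ⟨x, le_normalizer x.2⟩ : S) = φ x := by
  obtain ⟨Q, e, he, -, hrec, haut⟩ := hF.exists_equiv hS P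
  obtain ⟨f, hfF, hf⟩ := hrec.exists_normalizer_equiv e he haut (hP Q ⟨e, he⟩)
  obtain ⟨f', hfF', hf'⟩ := hrec.exists_normalizer_equiv ((φ : P ≃* P).trans e)
    (F.comp_mem hφ he) (fun g hg => haut (φ * g * φ⁻¹) ((mem_normalizer_iff.1 hn g).1 hg))
    (hP Q ⟨e, he⟩)
  refine ⟨f'.trans f.symm, F.comp_mem hfF' (symm_mem hfF), fun x => ?_⟩
  have h1 : f' ⟨x, le_normalizer x.2⟩ = f ⟨φ x, le_normalizer (φ x).2⟩ :=
    Subtype.ext ((hf' x).trans (hf (φ x)).symm)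
  change ((f.symm (f' ⟨x, le_normalizer x.2⟩) : normalizer (P : Set S)) : S) = φ x
  rw [h1, f.symm_apply_apply]

/-- A normal subgroup `Aut_S(P)` of `Aut_F(P)` gives a normal `p`-subgroup of `Out_F(P)`. It is
nontrivial if `C_S(P) ≤ P < S`, and then `P` is not essential. -/
theorem not_isEssential_of_normal {p : ℕ} [hp : Fact p.Prime] (hS : IsPGroup p S) {P : Subgroup S}
    (hc : centralizer (P : Set S) ≤ P) (hP : P ≠ ⊤)
    (hn : ((autS P).subgroupOf (F.aut P)).Normal) : ¬ F.IsEssential p P := by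
  rintro ⟨-, -, H, hH⟩
  set π := QuotientGroup.mk' ((innGroup P).subgroupOf (F.aut P))
  have hs : Function.Surjective π := QuotientGroup.mk'_surjective _
  have hN : (((autS P).subgroupOf (F.aut P)).map π).Normal := hn.map π hs
  have hp1 : IsPGroup p ((autS P).subgroupOf (F.aut P)) := (isPGroup_autS hS P).comap_subtype
  have hbot := hH.eq_bot_of_normal _ (hp1.map π)
  rw [Subgroup.map_eq_bot_iff, QuotientGroup.ker_mk'] at hbot
  have := hS.isNilpotent
  refine (Group.normalizerCondition_of_isNilpotent P (lt_top_iff_ne_top.2 hP)).not_ge ?_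
  intro g hg
  have hg1 : P.normalizerMonoidHom ⟨g, hg⟩ ∈ autS P := ⟨_, rfl⟩
  obtain ⟨h, hh⟩ := hbot (x := ⟨_, F.autS_le_aut P hg1⟩) hg1
  have h1 : (h : S)⁻¹ * g ∈ P := hc (mem_centralizer_iff.2 fun x hx => by
    have h2 : (h : S) * x * (h : S)⁻¹ = g * x * g⁻¹ :=
      congrArg Subtype.val (DFunLike.congr_fun hh (⟨x, hx⟩ : P))
    have h3 : (h : S) * x = g * x * g⁻¹ * h := by rw [← h2]; group
    have h4 : x * (h : S)⁻¹ = (h : S)⁻¹ * (g * x * g⁻¹) := by rw [← h2]; group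
    rw [← mul_assoc, h4]; group)
  have := P.mul_mem h.2 h1
  rwa [mul_inv_cancel_left] at this

end FusionSystem

/-! ### Invariant maximal subgroups above a pearl -/

namespace IsPGroup

open Subgroup
open scoped commutatorElement

variable {G : Type*} [Group G] [Finite G] {p : ℕ} [hp : Fact p.Prime]

/-- Let `A` be a self-centralizing subgroup of order `p ^ 2` of a group `G` of order `p ^ 4`. A
noncentral element `e ∈ A` has `p ^ 2` conjugates, which therefore fill the coset of the commutator
subgroup that contains `e`. -/
theorem exists_conj_eq_of_card_pow_four (hG : IsPGroup p G) (hG4 : Nat.card G = p ^ 4)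
    {A : Subgroup G} (hA : Nat.card A = p ^ 2) (hc : centralizer (A : Set G) ≤ A)
    (hM : Nat.card (commutator G) = p ^ 2) {e x : G} (he : e ∈ A) (heZ : e ∉ center G)
    (hx : x * e⁻¹ ∈ commutator G) :
    centralizer {e} ≤ A ∧ ∃ g, x = g * e * g⁻¹ := by
  have hZA : center G ≤ A := (center_le_centralizer _).trans hc
  have : Nontrivial G := ⟨e, 1, fun h => heZ (h ▸ one_mem _)⟩
  have h1 := (hG.centralizer_singleton_le A hA
    (by rw [inf_eq_right.2 hZA]; exact hG.center_ne_bot) he heZ).trans hc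
  refine ⟨h1, ?_⟩
  have h2 := index_centralizer_le_ncard e (Set.range fun g => g * e * g⁻¹) fun g => ⟨g, rfl⟩
  have h3 : p ^ 2 ≤ (centralizer {e}).index := by
    have h4 := (centralizer {e}).card_mul_index
    have h5 : Nat.card (centralizer {e}) ≤ p ^ 2 := hA ▸ card_le_of_le h1
    rw [hG4, pow_add p 2 2] at h4
    have hpos : 0 < p ^ 2 := pow_pos hp.out.pos 2
    by_contra hlt
    have := Nat.mul_lt_mul_of_le_of_lt h5 (not_le.1 hlt) hpos
    omega
  have h4 : (Set.range fun g => g * e * g⁻¹) ⊆ (fun c => c * e) '' (commutator G : Set G) := by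
    rintro _ ⟨g, rfl⟩
    exact ⟨⁅g, e⁆, commutator_mem_commutator (mem_top g) (mem_top e), by
      simp [commutatorElement_def]⟩
  have h5 : ((fun c => c * e) '' (commutator G : Set G)).ncard ≤ p ^ 2 := by
    rw [← hM]
    exact Set.ncard_image_le (Set.toFinite _)
  have h6 := Set.eq_of_subset_of_ncard_le h4 (h5.trans (h3.trans h2))
  have h7 : x ∈ (fun c => c * e) '' (commutator G : Set G) := ⟨_, hx, by simp⟩
  rw [← h6] at h7
  obtain ⟨g, hg⟩ := h7
  exact ⟨g, hg.symm⟩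

theorem card_commutator_of_card_pow_four (hG : IsPGroup p G) (hG4 : Nat.card G = p ^ 4)
    {A : Subgroup G} (hA : Nat.card A = p ^ 2) (hc : centralizer (A : Set G) ≤ A) :
    Nat.card (commutator G) = p ^ 2 := by
  have h1 := hG.index_commutator_le_sq_of_card_sq hA hc
  have h2 : (commutator G).index = p ^ 2 := by
    refine le_antisymm h1 (not_lt.1 fun hlt => ?_)
    have h3 := hG.mul_comm_of_index_commutator_le (hG.index_le_of_lt_sq _ hlt)
    have h4 : A = ⊤ := top_unique fun g _ => hc (mem_centralizer_iff.2 fun x _ => h3 x g)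
    rw [h4, card_top, hG4] at hA
    exact absurd (Nat.pow_right_injective hp.out.two_le hA) (by norm_num)
  have h3 := (commutator G).card_mul_index
  rw [h2, hG4, pow_add p 2 2] at h3
  exact Nat.eq_of_mul_eq_mul_right (pow_pos hp.out.pos 2) h3

theorem not_centralizer_commutator_le_of_card_pow_four (hG : IsPGroup p G)
    (hG4 : Nat.card G = p ^ 4)
    (hM : Nat.card (commutator G) = p ^ 2) :
    ¬ centralizer (commutator G : Set G) ≤ commutator G := by
  intro h
  have h1 := hG.index_centralizer_le_of_card_sq _ hM
  have h2 := (centralizer (commutator G : Set G)).card_mul_index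
  have h3 := Nat.mul_le_mul (hM ▸ card_le_of_le h) h1
  rw [h2, hG4, ← pow_succ] at h3
  exact absurd ((Nat.pow_le_pow_iff_right hp.out.one_lt).1 h3) (by norm_num)

/-- In a group of order `p ^ 4` with a self-centralizing subgroup `A` of order `p ^ 2`, let `P` be
a subgroup of index `p` that contains `A`. Each subgroup of order `p ^ 2` of `P` other than the
commutator subgroup is conjugate to `A`. -/
theorem exists_eq_map_conj_of_card_pow_four (hG : IsPGroup p G) (hG4 : Nat.card G = p ^ 4)
    {A P : Subgroup G} (hA : Nat.card A = p ^ 2) (hc : centralizer (A : Set G) ≤ A) (hAP : A ≤ P)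
    (hP : Nat.card P = p ^ 3) (hMP : commutator G ≤ P) {L : Subgroup G} (hLP : L ≤ P)
    (hL : Nat.card L = p ^ 2) (hLM : L ≠ commutator G) :
    ∃ g, L = A.map (MulAut.conj g).toMonoidHom := by
  have hM := hG.card_commutator_of_card_pow_four hG4 hA hc
  obtain ⟨x, hx, hxM⟩ : ∃ x ∈ L, x ∉ commutator G := by
    by_contra! h
    exact hLM (eq_of_le_of_card_ge h (hM.trans hL.symm).le)
  have hAM : ¬ A ≤ commutator G := fun h => by
    have := eq_of_le_of_card_ge h (hM.trans hA.symm).le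
    rw [this] at hc
    exact hG.not_centralizer_commutator_le_of_card_pow_four hG4 hM hc
  have hsup : A ⊔ commutator G = P := by
    refine eq_of_le_of_card_ge (sup_le hAP hMP) (not_lt.1 fun hlt => hAM ?_)
    have h1 := hG.card_le_sq_of_lt_cube _ (hP ▸ hlt)
    rw [eq_of_le_of_card_ge (le_sup_right : commutator G ≤ A ⊔ commutator G) (hM ▸ h1)]
    exact le_sup_left
  obtain ⟨e, he, m, hm, rfl⟩ := mem_sup_of_normal_right.1 (hsup ▸ hLP hx)
  have heM : e ∉ commutator G := fun h => hxM (mul_mem h hm)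
  have hZM : center G ≤ commutator G := by
    have hZ : Nat.card (center G) ≤ p := by
      refine hG.card_le_of_lt_sq _ (not_le.1 fun h => ?_)
      have hZA : center G ≤ A := (center_le_centralizer _).trans hc
      have h1 : center G = A := eq_of_le_of_card_ge hZA (hA.trans_le h)
      rw [← h1, centralizer_eq_top_iff_subset.2 subset_rfl, h1, top_le_iff] at hc
      rw [hc, card_top, hG4] at hA
      exact absurd (Nat.pow_right_injective hp.out.two_le hA) (by norm_num)
    have hMbot : commutator G ≠ ⊥ := fun h => by
      rw [h, card_bot] at hM
      exact (Nat.one_lt_pow two_ne_zero hp.out.one_lt).ne hM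
    rw [← inf_eq_right]
    exact eq_of_le_of_card_ge inf_le_right
      (hZ.trans (hG.le_card_of_ne_bot _ (hG.inf_center_ne_bot _ hMbot)))
  obtain ⟨hce, g, hg⟩ := hG.exists_conj_eq_of_card_pow_four hG4 hA hc hM he (fun h => heM (hZM h))
    (x := e * m) ((inferInstance : (commutator G).Normal).conj_mem m hm e)
  refine ⟨g, eq_of_le_of_card_ge (fun y hy => ?_) ?_⟩
  · refine ⟨g⁻¹ * y * g, hce (mem_centralizer_singleton_iff.2 ?_), by simp [mul_assoc]⟩
    have h1 := hG.mul_comm_of_mem hL.le hx hy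
    rw [hg] at h1
    calc g⁻¹ * y * g * e = g⁻¹ * (y * (g * e * g⁻¹)) * g := by group
      _ = e * (g⁻¹ * y * g) := by rw [← h1]; group
  · rw [card_map_of_injective (MulAut.conj g).injective, hA, hL]

end IsPGroup

namespace FusionSystem

open Subgroup

variable {S : Type u} [Group S] [Finite S] {F : FusionSystem S} {p : ℕ} [hp : Fact p.Prime]

/-- Let `E` have order `p ^ 2`, and let `P` be its normalizer. The commutator subgroup `M` of the
normalizer of `P` is invariant under `Aut_F(P)`, because `M` does not contain its centralizer
while all other maximal subgroups of `P` are conjugate to the centric subgroup `E`. -/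
theorem exists_invariant_of_card_sq (hS : IsPGroup p S) {E : Subgroup S} (hE : E.IsPearlShaped p)
    (hc : F.IsCentric E) (hE2 : Nat.card E = p ^ 2) (hP : normalizer (E : Set S) ≠ ⊤) :
    ∃ M : Subgroup (normalizer (E : Set S)), M.index = p ∧
      ∀ α ∈ F.aut (normalizer (E : Set S)), ∀ x ∈ M, α x ∈ M := by
  set P := normalizer (E : Set S) with hPdef
  set N := normalizer (P : Set S) with hNdef
  have hEP : E ≤ P := le_normalizer
  have hPN : P ≤ N := le_normalizer
  have hEt : E ≠ ⊤ := fun h => hP (top_unique (h ▸ hEP))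
  have hP3 : Nat.card P = p ^ 3 := by rw [hE.card_normalizer_eq hS le_rfl hEt, hE2, ← pow_succ]
  have hN4 : Nat.card N = p ^ 4 := by rw [hE.card_normalizer_eq hS hEP hP, hP3, ← pow_succ]
  have hNp := hS.to_subgroup N
  have hA : Nat.card (E.subgroupOf N) = p ^ 2 := by rw [card_subgroupOf_of_le (hEP.trans hPN), hE2]
  have hcA := centralizer_subgroupOf_le (hEP.trans hPN) hE.1
  have hM := hNp.card_commutator_of_card_pow_four hN4 hA hcA
  have hMP : _root_.commutator N ≤ P.subgroupOf N := by
    refine hNp.commutator_le_of_index_le_sq (P.subgroupOf N) (le_trans (le_of_eq ?_)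
      (Nat.le_self_pow two_ne_zero p))
    exact hE.relIndex_normalizer_eq hS hEP hP
  set M : Subgroup S := (_root_.commutator N).map N.subtype with hMdef
  have hM2 : Nat.card M = p ^ 2 := by rw [card_map_of_injective N.subtype_injective, hM]
  have hMP' : M ≤ P := by
    rintro _ ⟨x, hx, rfl⟩
    exact hMP hx
  have hMc : ¬ centralizer (M : Set S) ≤ M := fun h =>
    hNp.not_centralizer_commutator_le_of_card_pow_four hN4 hM fun x hx => by
      obtain ⟨y, hy, hyx⟩ := h (x := (x : S)) (mem_centralizer_iff.2 (by
        rintro _ ⟨z, hz, rfl⟩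
        exact congrArg Subtype.val (mem_centralizer_iff.1 hx z hz)))
      rwa [← Subtype.ext hyx]
  refine ⟨M.subgroupOf P, ?_, fun α hα x hx => ?_⟩
  · have h1 := (M.subgroupOf P).card_mul_index
    rw [card_subgroupOf_of_le hMP', hM2, hP3, pow_succ] at h1
    exact Nat.eq_of_mul_eq_mul_left (pow_pos hp.out.pos 2) h1
  · set L : Subgroup S := ((M.subgroupOf P).map α.toMonoidHom).map P.subtype with hLdef
    have hL2 : Nat.card L = p ^ 2 := by
      rw [card_map_of_injective P.subtype_injective, card_map_of_injective α.injective,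
        card_subgroupOf_of_le hMP', hM2]
    have hLP : L ≤ P := map_subtype_le _
    have hxL : (α x : S) ∈ L := ⟨α x, ⟨x, hx, rfl⟩, rfl⟩
    -- If `L = α(M)` were not `M`, it would be a conjugate of `E`, and composing that conjugation
    -- with `α⁻¹` would be a morphism from `E` onto `M`, contrary to `E` being centric.
    by_cases hLM : L.subgroupOf N = _root_.commutator N
    · rw [mem_subgroupOf, hMdef, ← hLM]
      exact ⟨⟨α x, hPN (α x).2⟩, hxL, rfl⟩
    exfalso
    obtain ⟨g, hg⟩ := hNp.exists_eq_map_conj_of_card_pow_four hN4 hA hcA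
      (P := P.subgroupOf N) (fun y hy => hEP hy) (by rw [card_subgroupOf_of_le hPN, hP3]) hMP
      (L := L.subgroupOf N) (fun y hy => hLP hy)
      (by rw [card_subgroupOf_of_le (hLP.trans hPN), hL2]) hLM
    have hgE : ∀ y : S, y ∈ E → (g : S) * y * (g : S)⁻¹ ∈ L := fun y hy => by
      have : (g * ⟨y, hPN (hEP hy)⟩ * g⁻¹ : N) ∈ L.subgroupOf N := by
        rw [hg]
        exact ⟨⟨y, hPN (hEP hy)⟩, hy, rfl⟩
      exact this
    let c : E →* P := (((MulAut.conj (g : S)).toMonoidHom).comp E.subtype).codRestrict P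
      fun y => hLP (hgE y y.2)
    have hcF : c ∈ F.hom E P := F.conj_mem _ g fun y => rfl
    have hβ : (Subgroup.inclusion le_top).comp ((α⁻¹ : MulAut P).toMonoidHom.comp c) ∈
        F.hom E (⊤ : Subgroup S) :=
      F.comp_mem (F.comp_mem hcF (inv_mem hα)) (F.inclusion_mem le_top)
    have him : image ((Subgroup.inclusion le_top).comp ((α⁻¹ : MulAut P).toMonoidHom.comp c) :
        E →* (⊤ : Subgroup S)) = M := by
      refine eq_of_le_of_card_ge ?_ (by rw [card_image hβ, hE2, hM2])
      rintro _ ⟨y, rfl⟩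
      obtain ⟨_, ⟨z, hz, rfl⟩, hzy⟩ := hgE y y.2
      have h1 : c y = α z := Subtype.ext hzy.symm
      have h2 : (α⁻¹ : MulAut P) (c y) = z := by rw [h1]; exact α.symm_apply_apply z
      change (((α⁻¹ : MulAut P) (c y) : P) : S) ∈ M
      rw [h2]
      exact hz
    have := hc _ hβ
    rw [him] at this
    exact hMc this

theorem exists_invariant_of_card_cube (hS : IsPGroup p S) {X P : Subgroup S}
    (hc : centralizer (X : Set S) ≤ X) (hX : Nat.card X = p ^ 3)
    (hab : ∃ a ∈ X, ∃ b ∈ X, a * b ≠ b * a) (hXP : X < P) :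
    ∃ M : Subgroup P, M.index = p ∧ ∀ α ∈ F.aut P, ∀ x ∈ M, α x ∈ M := by
  obtain ⟨a, ha, b, hb, hab⟩ := hab
  obtain ⟨M, hM, hi⟩ := (hS.to_subgroup P).exists_characteristic_index_eq (X := X.subgroupOf P)
    (by rw [card_subgroupOf_of_le hXP.le, hX]) (a := ⟨a, hXP.le ha⟩) (b := ⟨b, hXP.le hb⟩) ha hb
    (fun h => hab (congrArg Subtype.val h)) (centralizer_subgroupOf_le hXP.le hc)
    (fun h => hXP.not_ge (subgroupOf_eq_top.1 h))
  exact ⟨M, hi, fun α _ x hx => hM.apply_mem α hx⟩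

theorem exists_invariant (hS : IsPGroup p S) {E P : Subgroup S} (hE : E.IsPearlShaped p)
    (hc : F.IsCentric E) (hEP : E < P) (hNP : normalizer (E : Set S) ≤ P) (hP : P ≠ ⊤) :
    ∃ M : Subgroup P, M.index = p ∧ ∀ α ∈ F.aut P, ∀ x ∈ M, α x ∈ M := by
  obtain ⟨hcE, h2 | ⟨h3, hab⟩⟩ := id hE
  · rcases hNP.eq_or_lt with rfl | hlt
    · exact exists_invariant_of_card_sq hS hE hc h2 hP
    · have hEt : E ≠ ⊤ := hEP.ne_top
      have hEN : E ≤ normalizer (E : Set S) := le_normalizer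
      refine exists_invariant_of_card_cube hS
        ((centralizer_le hEN).trans (hcE.trans hEN))
        (by rw [hE.card_normalizer_eq hS le_rfl hEt, h2, ← pow_succ]) ?_ hlt
      have := hS.isNilpotent
      obtain ⟨g, hg, hgE⟩ := SetLike.exists_of_lt
        (Group.normalizerCondition_of_isNilpotent E (lt_top_iff_ne_top.2 hEt))
      by_contra! hcomm
      exact hgE (hcE (mem_centralizer_iff.2 fun x hx => hcomm x (hEN hx) g hg))
  · exact exists_invariant_of_card_cube hS hcE h3 hab hEP

/-- `Aut_S(P)` is a Sylow `p`-subgroup of `Aut_F(P)`, which has a unique one because it leaves a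
maximal subgroup of `P` invariant. -/
theorem IsSaturated.autS_normal (hF : F.IsSaturated p) (hS : IsPGroup p S) {E P : Subgroup S}
    (hE : E.IsPearlShaped p) (hc : F.IsCentric E) (hEP : E < P)
    (hNP : normalizer (E : Set S) ≤ P) (hP : P ≠ ⊤) :
    ((autS P).subgroupOf (F.aut P)).Normal := by
  obtain ⟨M, hM, hinv⟩ := exists_invariant (F := F) hS hE hc hEP hNP hP
  obtain ⟨T, hT⟩ := hF.isFullyAutomized hS fun Q hQ =>
    card_normalizer_le_of_isConj hS hE hc hEP.le hQ
  rw [← hT]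
  exact (hS.to_subgroup P).sylow_mulAut_normal ((hE.subgroupOf hEP.le).index_commutator_le
    (hS.to_subgroup P)) M hM _ hinv T

/-- The extension to `N^i(E)` is built one step at a time: for `i > 0` each automorphism in
`Aut_F(N^i(E))` normalizes `Aut_S(N^i(E))`. -/
theorem IsSaturated.exists_extension_normalizerTower (hF : F.IsSaturated p) (hS : IsPGroup p S)
    {E : Subgroup S} (hE : E.IsPearlShaped p) (hc : F.IsCentric E) {m : ℕ}
    (hn : ∀ i, 1 ≤ i → i + 1 ≤ m →
      ((autS (normalizerTower E i)).subgroupOf (F.aut (normalizerTower E i))).Normal)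
    {φ : MulAut E} (hφ : φ ∈ F.aut E) (hφn : φ ∈ normalizer (autS E : Set (MulAut E))) {i : ℕ}
    (hi : i ≤ m) :
    ∃ ψ ∈ F.aut (normalizerTower E i),
      (∀ (x : E) (hx : (x : S) ∈ normalizerTower E i), (ψ ⟨x, hx⟩ : S) = φ x) ∧
      ∀ j ≤ i, ∀ x : normalizerTower E i, (x : S) ∈ normalizerTower E j →
        (ψ x : S) ∈ normalizerTower E j := by
  induction i with
  | zero =>
    refine ⟨φ, hφ, fun x _ => rfl, fun j hj x _ => ?_⟩
    rw [Nat.le_zero.1 hj]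
    exact (φ x).2
  | succ i ih =>
    obtain ⟨ψ, hψ, hψφ, hψj⟩ := ih (by omega)
    have hψn : ψ ∈ normalizer (autS (normalizerTower E i) : Set _) := by
      rcases Nat.eq_zero_or_pos i with rfl | hpos
      · have : ψ = φ := by
          ext x
          exact hψφ x x.2
        rw [this]
        exact hφn
      · have h1 := (normal_subgroupOf_iff (F.autS_le_aut _)).1 (hn i hpos hi)
        refine mem_normalizer_iff.2 fun g => ⟨fun hg => h1 g ψ hg hψ, fun hg => ?_⟩
        have := h1 _ ψ⁻¹ hg (inv_mem hψ)
        simpa [mul_assoc] using this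
    obtain ⟨χ, hχ, hχψ⟩ := hF.exists_extension hS
      (fun Q hQ => card_normalizer_le_of_isConj hS hE hc (le_normalizerTower E i) hQ) hψ hψn
    refine ⟨χ, hχ, fun x _ => ?_, fun j hj x hx => ?_⟩
    · exact (hχψ ⟨x, le_normalizerTower E i x.2⟩).trans (hψφ x _)
    · rcases hj.eq_or_lt with rfl | hlt
      · exact (χ x).2
      · have hxi : (x : S) ∈ normalizerTower E i :=
          normalizerTower_mono E (by omega : j ≤ i) hx
        have h1 := hχψ ⟨x, hxi⟩
        have h2 := hψj j (by omega) ⟨x, hxi⟩ hx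
        rw [← h1] at h2
        exact h2

end FusionSystem

/-! ### The structure above a pearl -/

theorem mainTheorem8 (p : ℕ) [Fact p.Prime] (hp : p ≠ 2)
    (S : Type u) [Group S] [Finite S] (hS : IsPGroup p S)
    (F : FusionSystem S) (hF : F.IsSaturated p)
    (E : Subgroup S) (hE : F.IsPearl p E) (m : ℕ) (hm : E.index = p ^ m) :
    HasMaximalNormalizerTower p m E ∧
    (∀ H : Subgroup S, E ≤ H ↔ ∃ i ≤ m, H = normalizerTower E i) ∧
    (∀ i, 1 ≤ i → i + 1 ≤ m →
      ¬ F.IsEssential p (normalizerTower E i) ∧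
      FusionSystem.autS (normalizerTower E i) ≤ F.aut (normalizerTower E i) ∧
      ((FusionSystem.autS (normalizerTower E i)).subgroupOf
        (F.aut (normalizerTower E i))).Normal) ∧
    (∀ φ ∈ F.aut E,
      φ ∈ Subgroup.normalizer (FusionSystem.autS E : Set (MulAut E)) →
      ∃ ψ ∈ F.aut (⊤ : Subgroup S),
        (∀ x : E, ((ψ ⟨x, Subgroup.mem_top _⟩ : (⊤ : Subgroup S)) : S) = φ x) ∧
        ∀ i ≤ m, ((normalizerTower E i).subgroupOf ⊤).map ψ.toMonoidHom =
          (normalizerTower E i).subgroupOf ⊤) := by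
  have hEs := hE.isPearlShaped
  have hc : F.IsCentric E := hE.1.1
  have hne : ∀ i, i + 1 ≤ m → normalizerTower E i ≠ ⊤ := fun i hi h => by
    have := (hEs.normalizerTower_eq_top_iff hS hm (by omega)).1 h
    omega
  have hnormal : ∀ i, 1 ≤ i → i + 1 ≤ m → ((FusionSystem.autS (normalizerTower E i)).subgroupOf
      (F.aut (normalizerTower E i))).Normal := fun i h1 hi => by
    have := hS.isNilpotent
    have hN : Subgroup.normalizer (E : Set S) ≤ normalizerTower E i :=
      Subgroup.normalizerTower_mono E h1
    exact hF.autS_normal hS hEs hc ((Group.normalizerCondition_of_isNilpotent E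
      (lt_top_iff_ne_top.2 (hne 0 (by omega)))).trans_le hN) hN (hne i hi)
  refine ⟨hEs.hasMaximalNormalizerTower hS hm, hEs.le_iff_exists_eq_normalizerTower hS hm,
    fun i h1 hi => ⟨?_, F.autS_le_aut _, hnormal i h1 hi⟩, fun φ hφ hφn => ?_⟩
  · have hle := Subgroup.le_normalizerTower E i
    exact FusionSystem.not_isEssential_of_normal hS
      ((Subgroup.centralizer_le hle).trans (hEs.1.trans hle)) (hne i hi) (hnormal i h1 hi)
  · have h := hF.exists_extension_normalizerTower hS hEs hc hnormal hφ hφn (le_refl m)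
    rw [(hEs.normalizerTower_eq_top_iff hS hm le_rfl).2 rfl] at h
    obtain ⟨ψ, hψ, hψφ, hψj⟩ := h
    refine ⟨ψ, hψ, fun x => hψφ x _, fun i hi => ?_⟩
    refine Subgroup.eq_of_le_of_card_ge ?_ (by
      rw [Subgroup.card_map_of_injective ψ.injective])
    rintro _ ⟨x, hx, rfl⟩
    exact hψj i hi x hx
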